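/- Write $\langle x\rangle=(1+x^2)^{1/2}$. Let $\{\kappa_n\}_{n=1}^\infty$ be an arbitrary sequence of positive real numbers (repetitions allowed). Then there is a function $W\in C^\infty(\mathbb{R};\mathbb{R})$ such that, for every $n$, $\kappa_n^2$ is an eigenvalue of $-\Delta+W$ on $L^2(\mathbb{R})$, where $\Delta=d^2/dx^2$; that is, there is a nonzero $u\in H^2(\mathbb{R})$ with $Wu\in L^2(\mathbb{R})$ and $-u''+Wu=\kappa_n^2u$. Moreover, $W$ can be chosen such that $$ W(x)=\sum_{n=1}^\infty e^{2i\kappa_n x}w_{2\kappa_n}(x)+\sum_{n=1}^\infty e^{-2i\kappa_n x}w_{-2\kappa_n}(x)+w_0(x),\qquad x\in\mathbb{R}, $$ with both series convergent, where $w_0\in C_c^\infty(\mathbb{R})$ and $w_{2\kappa_n},w_{-2\kappa_n}\in C^\infty(\mathbb{R};\mathbb{C})$ (one pair of functions for each index $n$) satisfy: for all integers $k,N\ge 0$ there is a constant $C_{k,N}$ such that $$ |\partial_x^k w_{\pm 2\kappa_n}(x)|\le C_{k,N}\,\langle n\rangle^{-N}\langle\kappa_n\rangle^{-N}\langle x\rangle^{-k}\qquad\text{for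 all } n\ge 1,\ x\in\mathbb{R}. $$ -/

import Mathlib

open MeasureTheory TemperedDistribution
open scoped SchwartzMap Laplacian ContDiff ENNReal

noncomputable section

namespace SchrodingerLine

/-- The Japanese bracket `⟨x⟩ = (1 + x²)^{1/2}`. -/
def bracket (x : ℝ) : ℝ := √(1 + x ^ 2)

/-- The complex Hilbert space `L²(ℝ)`. -/
abbrev L2 : Type := Lp ℂ 2 (volume : Measure ℝ)

/-- The embedding of `L²(ℝ)` into the tempered distributions. -/
abbrev toDist (u : L2) : 𝓢'(ℝ, ℂ) := Lp.toTemperedDistributionCLM ℂ volume 2 u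

theorem toDist_injective : Function.Injective toDist :=
  LinearMap.ker_eq_bot.mp
    (Lp.ker_toTemperedDistributionCLM_eq_bot (F := ℂ) (μ := (volume : Measure ℝ)) (p := 2))

/-- The Sobolev space `H²(ℝ)`, as a subspace of `L²(ℝ)`. -/
def sobolevH2 : Submodule ℂ L2 where
  carrier := {u | MemSobolev 2 2 (toDist u)}
  zero_mem' := by
    rw [Set.mem_ofPred_eq, toDist, map_zero]
    exact memSobolev_fun_zero ℝ ℂ 2 2
  add_mem' {u v} hu hv := by
    rw [Set.mem_ofPred_eq, toDist, map_add]
    exact MemSobolev.add hu hv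
  smul_mem' c u hu := by
    rw [Set.mem_ofPred_eq, toDist, map_smul]
    exact MemSobolev.smul c hu

theorem exists_laplacian (u : sobolevH2) : ∃ v : L2, toDist v = Δ (toDist u) := by
  have h : MemSobolev (2 - 2) 2 (Δ (toDist u)) := MemSobolev.laplacian u.2
  rw [sub_self, memSobolev_zero_iff] at h
  obtain ⟨v, hv⟩ := h
  exact ⟨v, hv.symm⟩

/-- The Laplacian `Δ = d²/dx²` from `H²(ℝ)` to `L²(ℝ)`, in the sense of distributions. -/
def laplacianH2 : sobolevH2 →ₗ[ℂ] L2 where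
  toFun u := (exists_laplacian u).choose
  map_add' u v := by
    apply toDist_injective
    have h := (exists_laplacian (u + v)).choose_spec
    have hu := (exists_laplacian u).choose_spec
    have hv := (exists_laplacian v).choose_spec
    rw [h]
    simp only [toDist, Submodule.coe_add, map_add] at hu hv ⊢
    rw [hu, hv, ← laplacianCLM_apply, ← laplacianCLM_apply, ← laplacianCLM_apply, map_add]
  map_smul' c u := by
    apply toDist_injective
    have h := (exists_laplacian (c • u)).choose_spec
    have hu := (exists_laplacian u).choose_spec
    rw [h]
    simp only [toDist, Submodule.coe_smul, map_smul, RingHom.id_apply] at hu ⊢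
    rw [hu, ← laplacianCLM_apply, ← laplacianCLM_apply, map_smul]

theorem toDist_laplacianH2 (u : sobolevH2) : toDist (laplacianH2 u) = Δ (toDist u) :=
  (exists_laplacian u).choose_spec

/-- The maximal domain `{u ∈ L² : W u ∈ L²}` of multiplication by `W`
(all of `L²` if `W` is bounded and measurable). -/
def mulDomain (W : ℝ → ℝ) : Submodule ℂ L2 where
  carrier := {u | MemLp (fun x => (W x : ℂ) * u x) 2 volume}
  zero_mem' := by
    refine (memLp_congr_ae ?_).mpr (MemLp.zero' (ε := ℂ))
    filter_upwards [Lp.coeFn_zero ℂ 2 (volume : Measure ℝ)] with x hx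
    rw [hx, Pi.zero_apply, mul_zero]
  add_mem' {u v} hu hv := by
    refine (memLp_congr_ae ?_).mpr (MemLp.add hu hv)
    filter_upwards [Lp.coeFn_add u v] with x hx
    rw [hx, Pi.add_apply, Pi.add_apply, mul_add]
  smul_mem' c u hu := by
    refine (memLp_congr_ae ?_).mpr (MemLp.const_smul hu c)
    filter_upwards [Lp.coeFn_smul c u] with x hx
    rw [hx, Pi.smul_apply, Pi.smul_apply, smul_eq_mul, smul_eq_mul, mul_left_comm]

theorem memLp_mul {W : ℝ → ℝ} (u : mulDomain W) :
    MemLp (fun x => (W x : ℂ) * (u : L2) x) 2 volume := u.2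

/-- The operator of multiplication by `W` in `L²(ℝ)`, on its maximal domain. -/
def mulOp (W : ℝ → ℝ) : L2 →ₗ.[ℂ] L2 where
  domain := mulDomain W
  toFun :=
    { toFun := fun u => MemLp.toLp (fun x => (W x : ℂ) * (u : L2) x) (memLp_mul u)
      map_add' := fun u v => by
        rw [← MemLp.toLp_add (memLp_mul u) (memLp_mul v)]
        apply MemLp.toLp_congr
        filter_upwards [Lp.coeFn_add (u : L2) (v : L2)] with x hx
        rw [Submodule.coe_add, hx, Pi.add_apply, Pi.add_apply, mul_add]
      map_smul' := fun c u => by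
        rw [RingHom.id_apply, ← MemLp.toLp_const_smul c (memLp_mul u)]
        apply MemLp.toLp_congr
        filter_upwards [Lp.coeFn_smul c (u : L2)] with x hx
        rw [Submodule.coe_smul, hx, Pi.smul_apply, Pi.smul_apply, smul_eq_mul, smul_eq_mul,
          mul_left_comm] }

/-- The Schrödinger operator `-Δ + W` in `L²(ℝ)` with domain `{u ∈ H²(ℝ) : W u ∈ L²(ℝ)}`;
for bounded measurable real `W` this is the usual self-adjoint operator with domain `H²(ℝ)`. -/
def schrodinger (W : ℝ → ℝ) : L2 →ₗ.[ℂ] L2 :=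
  (-(⟨sobolevH2, laplacianH2⟩ : L2 →ₗ.[ℂ] L2)) + mulOp W

/-- `E` is an eigenvalue of the unbounded operator `A`. -/
def IsEigenvalue (A : L2 →ₗ.[ℂ] L2) (E : ℂ) : Prop :=
  ∃ u : A.domain, (u : L2) ≠ 0 ∧ A u = E • (u : L2)

/-- A family `(wₙ)` of smooth functions on `ℝ` with
`|∂ₓᵏ wₙ(x)| ≤ C_{k,N} ⟨n⟩^{-N} ⟨κₙ⟩^{-N} ⟨x⟩^{-k}` for all `k` and `N`. -/
def IsRapidSymbolFamily (κ : ℕ+ → ℝ) (w : ℕ+ → ℝ → ℂ) : Prop :=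
  (∀ n, ContDiff ℝ ∞ (w n)) ∧
  ∀ k N : ℕ, ∃ C : ℝ, ∀ (n : ℕ+) (x : ℝ),
    ‖iteratedDeriv k (w n) x‖ ≤
      C * bracket (n : ℝ) ^ (-(N : ℤ)) * bracket (κ n) ^ (-(N : ℤ)) * bracket x ^ (-(k : ℤ))

end SchrodingerLine

end

/-!
The potential is even and is built from dyadic shells `2 ^ j < |x| < 2 ^ (j + 1)`. In the `j`-th
shell it has a single frequency `2κₙ`, with `n = visit j`, and size about `2 ^ (-j)`; every index
`n` recurs with bounded gaps. The candidate for the eigenfunction at energy `κₘ²` is the even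
solution `u` of `u'' = (W - κₘ²) u` with `u 0 = 1`. It is written as `u = Re (Z e^{iκₘx})`, where the
complex amplitude `Z` is constant as long as the potential vanishes.

In a shell of frequency `2κₙ` the equation for `Z` has oscillating coefficients, and a resonant
non-oscillating one if `κₙ = κₘ`. The oscillating terms have an effect of relative size
`O(2 ^ (-j))` (`norm_sub_le_of_oscillating`). So a shell with `κₙ ≠ κₘ` changes `Z` by a factor close
to `1` (`exists_shell_nonresonant`), and a shell with `κₙ = κₘ` multiplies it by nearly `e^{-D}`, if
its phase is adapted to the value of `Z` at the inner radius (`exists_shell_resonant`). That value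
depends on the preceding shells only, so the phases can be chosen one after the other
(`partialPotential`, `shellPhase_spec`). These estimates hold for `j` large depending on `n` and `m`
only. The shells of `n` are therefore switched off for small `j`, in such a way that for each `m` all
but finitely many shells are under control (`exists_gate`). The strengths `D` are chosen so large
that the gain at the visits of `m` outweighs a factor `2` in each other shell. This gives
`u = O(x⁻²)` (`exists_amplitude_decay`), hence an eigenvector in `H²` (`isEigenvalue_of_decay`).

The coefficient of `e^{2iκₙx}` is the sum of the envelopes of the shells of `n`. Dilates of a bump are
symbols of order `0` uniformly in the scale, and starting late enough makes their sum as small as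
`e^{-n-κₙ}` (`isRapidSymbolFamily_coefficient`).
-/

namespace SchrodingerLine

/-! ### Global solutions of linear differential equations -/

section LinearODE

open Set

variable {E : Type*} [NormedAddCommGroup E] [NormedSpace ℝ E]

/-- The terms of the Volterra (Dyson) series of the linear equation `y' = A y`, `y 0 = y₀`:
iterated integrals of `A`, starting with the constant `y₀`. -/
noncomputable def volterraTerm (A : ℝ → E →L[ℝ] E) (y₀ : E) : ℕ → ℝ → E
  | 0 => fun _ => y₀
  | k + 1 => fun t => ∫ s in (0 : ℝ)..t, A s (volterraTerm A y₀ k s)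

theorem continuous_volterraTerm {A : ℝ → E →L[ℝ] E} (hA : Continuous A) (y₀ : E) (k : ℕ) :
    Continuous (volterraTerm A y₀ k) := by
  induction k with
  | zero => exact continuous_const
  | succ k ih =>
    exact intervalIntegral.continuous_primitive
      (fun a b => (hA.clm_apply ih).intervalIntegrable a b) 0

theorem hasDerivAt_volterraTerm_succ [CompleteSpace E] {A : ℝ → E →L[ℝ] E}
    (hA : Continuous A) (y₀ : E) (k : ℕ) (t : ℝ) :
    HasDerivAt (volterraTerm A y₀ (k + 1)) (A t (volterraTerm A y₀ k t)) t :=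
  intervalIntegral.integral_hasDerivAt_right
    ((hA.clm_apply (continuous_volterraTerm hA y₀ k)).intervalIntegrable 0 t)
    ((hA.clm_apply (continuous_volterraTerm hA y₀ k)).stronglyMeasurableAtFilter _ _)
    (hA.clm_apply (continuous_volterraTerm hA y₀ k)).continuousAt

theorem norm_volterraTerm_le_of_nonneg [CompleteSpace E] {A : ℝ → E →L[ℝ] E}
    (hA : Continuous A) (y₀ : E) {K T : ℝ} (hK : ∀ t ∈ Icc 0 T, ‖A t‖ ≤ K) (k : ℕ) :
    ∀ t ∈ Icc 0 T, ‖volterraTerm A y₀ k t‖ ≤ (K * t) ^ k / k.factorial * ‖y₀‖ := by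
  induction k with
  | zero => intro t _; simp [volterraTerm]
  | succ k ih =>
    refine image_norm_le_of_norm_deriv_right_le_deriv_boundary
      (f' := fun t => A t (volterraTerm A y₀ k t))
      (B' := fun t => K * ((K * t) ^ k / k.factorial * ‖y₀‖))
      (continuous_volterraTerm hA y₀ (k + 1)).continuousOn
      (fun t _ => (hasDerivAt_volterraTerm_succ hA y₀ k t).hasDerivWithinAt) ?_ ?_ ?_
    · simp [volterraTerm]
    · intro t
      have h := ((((hasDerivAt_id t).const_mul K).pow (k + 1)).div_const
        ((k + 1).factorial : ℝ)).mul_const ‖y₀‖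
      convert! h using 1
      have : (k.factorial : ℝ) ≠ 0 := by positivity
      simp only [Nat.factorial_succ, id]
      push_cast
      field_simp
    · intro t ht
      have ht' : t ∈ Icc 0 T := ⟨ht.1, ht.2.le⟩
      have hK0 : 0 ≤ K := (norm_nonneg _).trans (hK t ht')
      exact ((A t).le_opNorm _).trans
        (mul_le_mul (hK t ht') (ih t ht') (norm_nonneg _) hK0)

theorem volterraTerm_neg (A : ℝ → E →L[ℝ] E) (y₀ : E) (k : ℕ) (t : ℝ) :
    volterraTerm A y₀ k (-t) = volterraTerm (fun s => -A (-s)) y₀ k t := by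
  induction k generalizing t with
  | zero => rfl
  | succ k ih =>
    simp only [volterraTerm]
    have h := intervalIntegral.integral_comp_neg (a := 0) (b := t)
      (fun s => A s (volterraTerm A y₀ k s))
    rw [neg_zero] at h
    rw [intervalIntegral.integral_symm, ← h, ← intervalIntegral.integral_neg]
    simp only [ih, neg_apply]

theorem norm_volterraTerm_le [CompleteSpace E] {A : ℝ → E →L[ℝ] E} (hA : Continuous A) (y₀ : E)
    {K T : ℝ} (hK : ∀ t ∈ Icc (-T) T, ‖A t‖ ≤ K) (k : ℕ) :
    ∀ t ∈ Icc (-T) T, ‖volterraTerm A y₀ k t‖ ≤ (K * |t|) ^ k / k.factorial * ‖y₀‖ := by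
  intro t ht
  rcases le_total 0 t with h | h
  · rw [abs_of_nonneg h]
    refine norm_volterraTerm_le_of_nonneg (T := T) hA y₀ (fun s hs => hK s ⟨?_, hs.2⟩) k t ⟨h, ht.2⟩
    linarith [hs.1, hs.2]
  · rw [abs_of_nonpos h]
    have := norm_volterraTerm_le_of_nonneg (A := fun s => -A (-s)) (K := K) (T := T)
      (by fun_prop) y₀ (fun s hs => by
        rw [norm_neg]; exact hK _ ⟨by linarith [hs.2], by linarith [hs.1, hs.2]⟩) k (-t)
      ⟨by linarith, by linarith [ht.1]⟩
    rwa [← volterraTerm_neg, neg_neg] at this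

/-- A linear equation `y' = A y` with continuous coefficients has a solution on all of `ℝ`,
the sum of its Volterra series. -/
theorem exists_global_solution_linear [CompleteSpace E] {A : ℝ → E →L[ℝ] E}
    (hA : Continuous A) (y₀ : E) :
    ∃ y : ℝ → E, y 0 = y₀ ∧ ∀ t, HasDerivAt y (A t (y t)) t := by
  refine ⟨fun t => ∑' k, volterraTerm A y₀ k t, ?_, fun t => ?_⟩
  · dsimp only
    rw [tsum_eq_single 0]
    · rfl
    · intro k hk
      obtain ⟨m, rfl⟩ := Nat.exists_eq_succ_of_ne_zero hk
      simp [volterraTerm]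
  · obtain ⟨T, hT⟩ : ∃ T, |t| < T := exists_gt _
    have hT0 : 0 < T := (abs_nonneg t).trans_lt hT
    obtain ⟨K, hK⟩ := isCompact_Icc.exists_bound_of_continuousOn
      (s := Icc (-T) T) (f := A) hA.continuousOn
    have hK0 : 0 ≤ K := (norm_nonneg _).trans (hK 0 ⟨by linarith, hT0.le⟩)
    have hbound : ∀ k, ∀ s ∈ Ioo (-T) T,
        ‖volterraTerm A y₀ k s‖ ≤ (K * T) ^ k / k.factorial * ‖y₀‖ := fun k s hs =>
      (norm_volterraTerm_le hA y₀ hK k s (Ioo_subset_Icc_self hs)).trans (by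
        have := (abs_lt.2 hs).le
        gcongr)
    have hsum : Summable fun k : ℕ => (K * T) ^ k / k.factorial * ‖y₀‖ :=
      (Real.summable_pow_div_factorial _).mul_right _
    let g' : ℕ → ℝ → E := fun k s => Nat.casesOn k 0 fun m => A s (volterraTerm A y₀ m s)
    let v : ℕ → ℝ := fun k => Nat.casesOn k 0 fun m => K * ((K * T) ^ m / m.factorial * ‖y₀‖)
    have hv : Summable v := (summable_nat_add_iff 1).1 (hsum.mul_left K)
    have htT : t ∈ Ioo (-T) T := abs_lt.1 hT
    have hsumt : ∀ s ∈ Ioo (-T) T, Summable fun k => volterraTerm A y₀ k s := fun s hs =>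
      Summable.of_norm_bounded hsum fun k => hbound k s hs
    have hg' : ∀ k, ∀ s ∈ Ioo (-T) T, ‖g' k s‖ ≤ v k := by
      intro k s hs
      cases k with
      | zero => simp [g', v]
      | succ m =>
        exact ((A s).le_opNorm _).trans
          (mul_le_mul (hK s (Ioo_subset_Icc_self hs)) (hbound m s hs) (norm_nonneg _) hK0)
    have key := hasDerivAt_tsum_of_isPreconnected (g := fun k s => volterraTerm A y₀ k s)
      (g' := g') hv isOpen_Ioo
      isPreconnected_Ioo (fun k s _ => by
        cases k with
        | zero => exact hasDerivAt_const s y₀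
        | succ m => exact hasDerivAt_volterraTerm_succ hA y₀ m s)
      hg' htT (hsumt t htT) htT
    convert! key using 1
    rw [(A t).map_tsum (hsumt t htT),
      (Summable.of_norm_bounded hv fun k => hg' k t htT).tsum_eq_zero_add]
    simp [g']

end LinearODE

/-! ### The stationary Schrödinger equation as a first order system -/

section Stationary

open Set

/-- `u'' = (V - k²) u` on `s`, written as the first order system for `u` and `v = u'`. -/
def SolvesOn (V : ℝ → ℝ) (k : ℝ) (u v : ℝ → ℝ) (s : Set ℝ) : Prop :=
  ∀ x ∈ s, HasDerivAt u (v x) x ∧ HasDerivAt v ((V x - k ^ 2) * u x) x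

theorem exists_solvesOn_univ {V : ℝ → ℝ} (hV : Continuous V) (k : ℝ) :
    ∃ y : (ℝ → ℝ) × (ℝ → ℝ), y.1 0 = 1 ∧ y.2 0 = 0 ∧ SolvesOn V k y.1 y.2 univ := by
  let A : ℝ → ℝ × ℝ →L[ℝ] ℝ × ℝ := fun t =>
    (ContinuousLinearMap.snd ℝ ℝ ℝ).prod ((V t - k ^ 2) • ContinuousLinearMap.fst ℝ ℝ ℝ)
  have hA : Continuous A := by
    have h1 : Continuous fun t => (V t - k ^ 2) • ContinuousLinearMap.fst ℝ ℝ ℝ := by fun_prop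
    exact (ContinuousLinearMap.prodₗᵢ ℝ).continuous.comp
      (continuous_const.prodMk h1)
  obtain ⟨y, hy0, hy⟩ := exists_global_solution_linear hA ((1, 0) : ℝ × ℝ)
  refine ⟨(fun t => (y t).1, fun t => (y t).2), by simp [hy0], by simp [hy0], fun x _ => ⟨?_, ?_⟩⟩
  · have := (ContinuousLinearMap.fst ℝ ℝ ℝ).hasFDerivAt.comp_hasDerivAt x (hy x)
    simpa [A] using! this
  · have := (ContinuousLinearMap.snd ℝ ℝ ℝ).hasFDerivAt.comp_hasDerivAt x (hy x)
    simpa [A] using! this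

theorem SolvesOn.eqOn {V : ℝ → ℝ} {k T : ℝ} {u₁ v₁ u₂ v₂ : ℝ → ℝ}
    (hV : ContinuousOn V (Icc 0 T))
    (h₁ : SolvesOn V k u₁ v₁ (Icc 0 T)) (h₂ : SolvesOn V k u₂ v₂ (Icc 0 T))
    (hu : u₁ 0 = u₂ 0) (hv : v₁ 0 = v₂ 0) :
    ∀ x ∈ Icc 0 T, u₁ x = u₂ x ∧ v₁ x = v₂ x := by
  obtain ⟨K, hK⟩ := isCompact_Icc.exists_bound_of_continuousOn
    (s := Icc 0 T) (f := fun x => V x - k ^ 2) (by fun_prop)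
  have hder : ∀ x ∈ Icc 0 T, HasDerivAt (fun x => (u₁ x - u₂ x, v₁ x - v₂ x))
      (v₁ x - v₂ x, (V x - k ^ 2) * u₁ x - (V x - k ^ 2) * u₂ x) x := fun x hx =>
    ((h₁ x hx).1.sub (h₂ x hx).1).prodMk ((h₁ x hx).2.sub (h₂ x hx).2)
  have key := eq_zero_of_abs_deriv_le_mul_abs_self_of_eq_zero_right (K := max 1 K)
    (fun x hx => (hder x hx).continuousAt.continuousWithinAt)
    (fun x hx => (hder x (Ico_subset_Icc_self hx)).hasDerivWithinAt)
    (by simp [hu, hv]) (fun x hx => by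
      have hx' := Ico_subset_Icc_self hx
      rw [Prod.norm_def, Prod.norm_def]
      refine max_le ?_ ?_
      · have : (0 : ℝ) ≤ max ‖u₁ x - u₂ x‖ ‖v₁ x - v₂ x‖ := le_max_of_le_left (norm_nonneg _)
        calc ‖v₁ x - v₂ x‖ ≤ 1 * max ‖u₁ x - u₂ x‖ ‖v₁ x - v₂ x‖ := by
              rw [one_mul]; exact le_max_right _ _
          _ ≤ _ := by gcongr; exact le_max_left _ _
      · rw [← mul_sub, norm_mul]
        exact mul_le_mul ((hK x hx').trans (le_max_right _ _)) (le_max_left _ _)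
          (norm_nonneg _) (zero_le_one.trans (le_max_left _ _)))
  intro x hx
  have := key x hx
  rw [Prod.mk_eq_zero] at this
  exact ⟨sub_eq_zero.1 this.1, sub_eq_zero.1 this.2⟩

/-- The solution `(u, u')` of `u'' = (V - k²) u` with `u 0 = 1` and `u' 0 = 0`; it exists for
continuous `V`, and the value for other `V` is irrelevant. -/
noncomputable def neumannSol (V : ℝ → ℝ) (k : ℝ) : (ℝ → ℝ) × (ℝ → ℝ) :=
  Classical.epsilon fun y : (ℝ → ℝ) × (ℝ → ℝ) =>
    y.1 0 = 1 ∧ y.2 0 = 0 ∧ SolvesOn V k y.1 y.2 univ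

theorem neumannSol_spec {V : ℝ → ℝ} (hV : Continuous V) (k : ℝ) :
    (neumannSol V k).1 0 = 1 ∧ (neumannSol V k).2 0 = 0 ∧
      SolvesOn V k (neumannSol V k).1 (neumannSol V k).2 univ :=
  Classical.epsilon_spec (exists_solvesOn_univ hV k)

/-- The solution on `[0, T]` depends on the potential on `[0, T]` only. -/
theorem neumannSol_congr {V₁ V₂ : ℝ → ℝ} (h₁ : Continuous V₁) (h₂ : Continuous V₂) {k T : ℝ}
    (h : ∀ x ∈ Icc 0 T, V₁ x = V₂ x) :
    ∀ x ∈ Icc 0 T, (neumannSol V₁ k).1 x = (neumannSol V₂ k).1 x ∧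
      (neumannSol V₁ k).2 x = (neumannSol V₂ k).2 x := by
  obtain ⟨a₁, b₁, c₁⟩ := neumannSol_spec h₁ k
  obtain ⟨a₂, b₂, c₂⟩ := neumannSol_spec h₂ k
  refine SolvesOn.eqOn (V := V₁) (k := k) h₁.continuousOn (fun x hx => c₁ x trivial)
    (fun x hx => ?_) (by rw [a₁, a₂]) (by rw [b₁, b₂])
  rw [h x hx]
  exact c₂ x trivial

/-- For an even potential the solution is even and its derivative is odd. -/
theorem neumannSol_neg {V : ℝ → ℝ} (hV : Continuous V) (heven : ∀ x, V (-x) = V x) (k x : ℝ) :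
    (neumannSol V k).1 (-x) = (neumannSol V k).1 x ∧
      (neumannSol V k).2 (-x) = -(neumannSol V k).2 x := by
  obtain ⟨a, b, c⟩ := neumannSol_spec hV k
  have key : ∀ x : ℝ, 0 ≤ x → (neumannSol V k).1 (-x) = (neumannSol V k).1 x ∧
      -(neumannSol V k).2 (-x) = (neumannSol V k).2 x := by
    intro x hx
    refine SolvesOn.eqOn (V := V) (k := k) (T := x)
      (u₁ := fun x => (neumannSol V k).1 (-x)) (v₁ := fun x => -(neumannSol V k).2 (-x))
      hV.continuousOn (fun y _ => ?_)
      (fun y _ => c y trivial) (by simp) (by simp [b]) x ⟨hx, le_rfl⟩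
    obtain ⟨h1, h2⟩ := c (-y) trivial
    have hn : HasDerivAt (fun y : ℝ => -y) (-1) y := hasDerivAt_neg y
    refine ⟨?_, ?_⟩
    · simpa using! h1.comp y hn
    · simpa [heven] using! (h2.comp y hn).neg
  rcases le_total 0 x with hx | hx
  · exact ⟨(key x hx).1, by rw [← (key x hx).2, neg_neg]⟩
  · have := key (-x) (by linarith)
    rw [neg_neg] at this
    exact ⟨this.1.symm, this.2.symm⟩

end Stationary

/-! ### Averaging of oscillating coefficients -/

section Averaging

open Set
open scoped ComplexConjugate

theorem gronwallBound_zero_le {K ε x : ℝ} (hK : 0 ≤ K) (hε : 0 ≤ ε) :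
    gronwallBound 0 K ε x ≤ ε * x * Real.exp (K * x) := by
  rcases hK.eq_or_lt with rfl | hK
  · simp [gronwallBound_K0]
  · rw [gronwallBound_of_K_ne_0 hK.ne']
    have h : Real.exp (K * x) - 1 ≤ K * x * Real.exp (K * x) := by
      have h1 := Real.add_one_le_exp (-(K * x))
      have h2 := Real.exp_pos (K * x)
      have h3 : Real.exp (-(K * x)) * Real.exp (K * x) = 1 := by
        rw [← Real.exp_add]; simp
      nlinarith
    calc 0 * Real.exp (K * x) + ε / K * (Real.exp (K * x) - 1)
        ≤ 0 * Real.exp (K * x) + ε / K * (K * x * Real.exp (K * x)) := by gcongr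
      _ = ε * x * Real.exp (K * x) := by field_simp; ring

/-- Averaging: in `Z' = p (-ζ conj Z + α Z + β conj Z)` the terms with `α` and `β`, which have
small primitives `A` and `B`, change the solution only by the size `η` of these primitives. The
correction `Z - p (A Z + B conj Z)` removes them up to terms that are small. -/
theorem norm_sub_le_of_oscillating {p p' : ℝ → ℝ} {Z R α β A B : ℝ → ℂ} {ζ : ℂ}
    {a b P P' M η : ℝ} (hab : a ≤ b) (hM : 0 ≤ M)
    (hp : ∀ x ∈ Icc a b, HasDerivAt p (p' x) x) (hpa : p a = 0)
    (hP : ∀ x ∈ Icc a b, |p x| ≤ P) (hP' : ∀ x ∈ Icc a b, |p' x| ≤ P')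
    (hα : ∀ x ∈ Icc a b, ‖α x‖ ≤ M) (hβ : ∀ x ∈ Icc a b, ‖β x‖ ≤ M)
    (hA : ∀ x ∈ Icc a b, HasDerivAt A (α x) x) (hB : ∀ x ∈ Icc a b, HasDerivAt B (β x) x)
    (hA' : ∀ x ∈ Icc a b, ‖A x‖ ≤ η) (hB' : ∀ x ∈ Icc a b, ‖B x‖ ≤ η) (hζ : ‖ζ‖ ≤ 1)
    (hZ : ∀ x ∈ Icc a b,
      HasDerivAt Z (p x * (-ζ * conj (Z x) + α x * Z x + β x * conj (Z x))) x)
    (hR : ∀ x ∈ Icc a b, HasDerivAt R (p x * (-ζ * conj (R x))) x) (hRa : R a = Z a) :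
    ∀ x ∈ Icc a b, ‖Z x - R x‖ ≤
      2 * η * Real.exp ((1 + 2 * M) * P * (b - a)) *
        ((P' + (2 + 2 * M) * P ^ 2) * (b - a) * Real.exp (P * (b - a)) + P) * ‖Z a‖ := by
  have ha : a ∈ Icc a b := ⟨le_rfl, hab⟩
  have hP0 : 0 ≤ P := (abs_nonneg _).trans (hP a ha)
  have hP'0 : 0 ≤ P' := (abs_nonneg _).trans (hP' a ha)
  have hη : 0 ≤ η := (norm_nonneg _).trans (hA' a ha)
  set S := Real.exp ((1 + 2 * M) * P * (b - a)) * ‖Z a‖ with hS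
  have hS0 : 0 ≤ S := by positivity
  have hZ'bound : ∀ x ∈ Icc a b,
      ‖(p x : ℂ) * (-ζ * conj (Z x) + α x * Z x + β x * conj (Z x))‖
        ≤ (1 + 2 * M) * P * ‖Z x‖ := by
    intro x hx
    rw [norm_mul, Complex.norm_real]
    have h1 : ‖-ζ * conj (Z x) + α x * Z x + β x * conj (Z x)‖
        ≤ 1 * ‖Z x‖ + M * ‖Z x‖ + M * ‖Z x‖ := by
      refine (norm_add₃_le).trans ?_
      simp only [norm_mul, norm_neg, RCLike.norm_conj]
      gcongr
      exacts [hα x hx, hβ x hx]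
    calc ‖p x‖ * ‖_‖ ≤ P * (1 * ‖Z x‖ + M * ‖Z x‖ + M * ‖Z x‖) :=
          mul_le_mul (hP x hx) h1 (norm_nonneg _) hP0
      _ = _ := by ring
  have hZbound : ∀ x ∈ Icc a b, ‖Z x‖ ≤ S := by
    intro x hx
    have := norm_le_gronwallBound_of_norm_deriv_right_le (δ := ‖Z a‖) (ε := 0)
      (fun x hx => (hZ x hx).continuousAt.continuousWithinAt)
      (fun x hx => (hZ x (Ico_subset_Icc_self hx)).hasDerivWithinAt) le_rfl
      (fun x hx => by simpa using hZ'bound x (Ico_subset_Icc_self hx)) x hx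
    rw [gronwallBound_ε0] at this
    refine this.trans ?_
    rw [hS, mul_comm]
    gcongr
    exact hx.2
  have hcorr : ∀ x ∈ Icc a b, ‖A x * Z x + B x * conj (Z x)‖ ≤ 2 * η * S := by
    intro x hx
    refine (norm_add_le _ _).trans ?_
    simp only [norm_mul, RCLike.norm_conj]
    have h := hZbound x hx
    calc ‖A x‖ * ‖Z x‖ + ‖B x‖ * ‖Z x‖ ≤ η * S + η * S := by
          gcongr
          exacts [hA' x hx, hB' x hx]
      _ = _ := by ring
  set Z' : ℝ → ℂ := fun x => p x * (-ζ * conj (Z x) + α x * Z x + β x * conj (Z x)) with hZ'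
  -- `Y` is the corrected difference; it vanishes at `a` because `p` does.
  set Y : ℝ → ℂ := fun x => Z x - p x * (A x * Z x + B x * conj (Z x)) - R x with hY
  set F : ℝ → ℂ := fun x => p x * (-ζ * conj (p x * (A x * Z x + B x * conj (Z x))))
    - p' x * (A x * Z x + B x * conj (Z x)) - p x * (A x * Z' x + B x * conj (Z' x)) with hF
  have hYder : ∀ x ∈ Icc a b, HasDerivAt Y (p x * (-ζ * conj (Y x)) + F x) x := by
    intro x hx
    have h1 : HasDerivAt (fun x => conj (Z x)) (conj (Z' x)) x := (hZ x hx).star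
    have h2 := ((hA x hx).mul (hZ x hx)).add ((hB x hx).mul h1)
    have h3 := (hp x hx).ofReal_comp
    have h4 := ((hZ x hx).sub (h3.mul h2)).sub (hR x hx)
    convert! h4 using 1
    simp only [hF, hZ', hY, map_sub, Pi.add_apply, Pi.mul_apply]
    ring
  have hFbound : ∀ x ∈ Icc a b, ‖F x‖ ≤ 2 * η * S * (P' + (2 + 2 * M) * P ^ 2) := by
    intro x hx
    have hp1 : ‖(p x : ℂ)‖ ≤ P := by rw [Complex.norm_real]; exact hP x hx
    have hp2 : ‖(p' x : ℂ)‖ ≤ P' := by rw [Complex.norm_real]; exact hP' x hx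
    have hc := hcorr x hx
    have hZz : ‖Z' x‖ ≤ (1 + 2 * M) * P * S :=
      (hZ'bound x hx).trans (by gcongr; exact hZbound x hx)
    have t1 : ‖(p x : ℂ) * (-ζ * conj (p x * (A x * Z x + B x * conj (Z x))))‖
        ≤ P * (1 * (P * (2 * η * S))) := by
      rw [norm_mul, norm_mul, norm_neg, RCLike.norm_conj, norm_mul]
      gcongr
    have t2 : ‖(p' x : ℂ) * (A x * Z x + B x * conj (Z x))‖ ≤ P' * (2 * η * S) := by
      rw [norm_mul]; gcongr
    have t3 : ‖(p x : ℂ) * (A x * Z' x + B x * conj (Z' x))‖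
        ≤ P * (η * ((1 + 2 * M) * P * S) + η * ((1 + 2 * M) * P * S)) := by
      rw [norm_mul]
      have : ‖A x * Z' x + B x * conj (Z' x)‖
          ≤ η * ((1 + 2 * M) * P * S) + η * ((1 + 2 * M) * P * S) := by
        refine (norm_add_le _ _).trans ?_
        simp only [norm_mul, RCLike.norm_conj]
        gcongr
        exacts [hA' x hx, hB' x hx]
      gcongr
    calc ‖F x‖ ≤ P * (1 * (P * (2 * η * S))) + P' * (2 * η * S)
          + P * (η * ((1 + 2 * M) * P * S) + η * ((1 + 2 * M) * P * S)) :=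
          (norm_sub_le _ _).trans (add_le_add ((norm_sub_le _ _).trans (add_le_add t1 t2)) t3)
      _ = _ := by ring
  intro x hx
  have hYbound := norm_le_gronwallBound_of_norm_deriv_right_le (δ := 0) (K := P)
      (ε := 2 * η * S * (P' + (2 + 2 * M) * P ^ 2))
      (fun x hx => (hYder x hx).continuousAt.continuousWithinAt)
      (fun x hx => (hYder x (Ico_subset_Icc_self hx)).hasDerivWithinAt)
      (by simp [hY, hpa, hRa])
      (fun x hx => by
        have hx' := Ico_subset_Icc_self hx
        refine (norm_add_le _ _).trans (add_le_add ?_ (hFbound x hx'))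
        rw [norm_mul, norm_mul, norm_neg, RCLike.norm_conj, Complex.norm_real]
        calc ‖p x‖ * (‖ζ‖ * ‖Y x‖) ≤ P * (1 * ‖Y x‖) := by
              gcongr
              exact hP x hx'
          _ = P * ‖Y x‖ := by ring) x hx
  have hYbound' := hYbound.trans (gronwallBound_zero_le hP0 (by positivity))
  have hsplit : Z x - R x = Y x + p x * (A x * Z x + B x * conj (Z x)) := by
    simp only [hY]; ring
  have hpx : ‖(p x : ℂ)‖ ≤ P := by rw [Complex.norm_real]; exact hP x hx
  calc ‖Z x - R x‖ ≤ ‖Y x‖ + ‖(p x : ℂ) * (A x * Z x + B x * conj (Z x))‖ := by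
        rw [hsplit]; exact norm_add_le _ _
    _ ≤ 2 * η * S * (P' + (2 + 2 * M) * P ^ 2) * (b - a) * Real.exp (P * (b - a))
        + P * (2 * η * S) := by
        rw [norm_mul]
        have hxb : x - a ≤ b - a := by linarith [hx.2]
        have hxa : 0 ≤ b - a := by linarith
        gcongr
        · refine hYbound'.trans ?_
          gcongr
        · exact hcorr x hx
    _ = _ := by rw [hS]; ring

end Averaging

/-! ### The effect of one shell -/

section Shell

open Set
open scoped ComplexConjugate

/-- The profile of a shell: a nonnegative smooth function supported in `[1, 2]` with integral `1`,
given as the derivative of an explicit transition from `0` to `1`. -/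
noncomputable def shellBump (y : ℝ) : ℝ := deriv Real.smoothTransition (y - 1)

theorem hasDerivAt_smoothTransition (y : ℝ) :
    HasDerivAt Real.smoothTransition (deriv Real.smoothTransition y) y :=
  ((Real.smoothTransition.contDiff (n := 1)).differentiable (by norm_num) y).hasDerivAt

theorem contDiff_shellBump : ContDiff ℝ ∞ shellBump := by
  have h : ContDiff ℝ ∞ (deriv Real.smoothTransition) :=
    (contDiff_infty_iff_deriv.1 Real.smoothTransition.contDiff).2
  exact h.comp (contDiff_id.sub contDiff_const)

theorem shellBump_of_le_one {y : ℝ} (hy : y ≤ 1) : shellBump y = 0 := by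
  have h : IsMinOn Real.smoothTransition univ (y - 1) := fun z _ => by
    simp [Real.smoothTransition.zero_of_nonpos (sub_nonpos.2 hy), Real.smoothTransition.nonneg]
  exact (h.isLocalMin Filter.univ_mem).deriv_eq_zero

theorem shellBump_of_two_le {y : ℝ} (hy : 2 ≤ y) : shellBump y = 0 := by
  have h : IsMaxOn Real.smoothTransition univ (y - 1) := fun z _ => by
    simp [Real.smoothTransition.one_of_one_le (show 1 ≤ y - 1 by linarith),
      Real.smoothTransition.le_one]
  exact (h.isLocalMax Filter.univ_mem).deriv_eq_zero

theorem hasCompactSupport_shellBump : HasCompactSupport shellBump := by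
  refine HasCompactSupport.intro (isCompact_Icc (a := (1 : ℝ)) (b := 2)) fun y hy => ?_
  rw [mem_Icc, not_and_or, not_le, not_le] at hy
  exact hy.elim (fun h => shellBump_of_le_one h.le) fun h => shellBump_of_two_le h.le

theorem exists_shellBump_bound :
    ∃ H : ℝ, 0 < H ∧ ∀ y, |shellBump y| ≤ H ∧ |deriv shellBump y| ≤ H := by
  obtain ⟨H₁, h₁⟩ := hasCompactSupport_shellBump.exists_bound_of_continuous
    contDiff_shellBump.continuous
  obtain ⟨H₂, h₂⟩ := hasCompactSupport_shellBump.deriv.exists_bound_of_continuous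
    (contDiff_infty_iff_deriv.1 contDiff_shellBump).2.continuous
  exact ⟨max 1 (max H₁ H₂), by positivity, fun y => ⟨(h₁ y).trans (by simp),
    (h₂ y).trans (by simp)⟩⟩

/-- The state `(u - i v / k) e^{-ikx}` of a solution with `v = u'`: the complex amplitude in
`u = Re (Z e^{ikx})`, which is constant where the potential vanishes. -/
noncomputable def amplitude (k : ℝ) (y : (ℝ → ℝ) × (ℝ → ℝ)) (x : ℝ) : ℂ :=
  (y.1 x - Complex.I * y.2 x / k) * Complex.exp (-(Complex.I * k * x))

theorem norm_amplitude (k : ℝ) (y : (ℝ → ℝ) × (ℝ → ℝ)) (x : ℝ) :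
    ‖amplitude k y x‖ = ‖(y.1 x : ℂ) - Complex.I * y.2 x / k‖ := by
  rw [amplitude, norm_mul]
  have : -(Complex.I * k * x) = ((-(k * x) : ℝ) : ℂ) * Complex.I := by push_cast; ring
  rw [this, Complex.norm_exp_ofReal_mul_I, mul_one]

theorem abs_fst_le_norm_amplitude (k : ℝ) (y : (ℝ → ℝ) × (ℝ → ℝ)) (x : ℝ) :
    |y.1 x| ≤ ‖amplitude k y x‖ := by
  rw [norm_amplitude]
  have := Complex.abs_re_le_norm ((y.1 x : ℂ) - Complex.I * y.2 x / k)
  have h : ((y.1 x : ℂ) - Complex.I * y.2 x / k).re = y.1 x := by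
    rw [mul_div_assoc, ← Complex.ofReal_div]; simp
  rwa [h] at this

theorem abs_snd_le_norm_amplitude {k : ℝ} (hk : 0 < k) (y : (ℝ → ℝ) × (ℝ → ℝ)) (x : ℝ) :
    |y.2 x| ≤ k * ‖amplitude k y x‖ := by
  rw [norm_amplitude]
  have := Complex.abs_im_le_norm ((y.1 x : ℂ) - Complex.I * y.2 x / k)
  have h : ((y.1 x : ℂ) - Complex.I * y.2 x / k).im = -(y.2 x / k) := by
    rw [mul_div_assoc, ← Complex.ofReal_div]; simp
  rw [h, abs_neg, abs_div, abs_of_pos hk, div_le_iff₀ hk] at this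
  linarith

theorem hasDerivAt_amplitude {k : ℝ} (hk : 0 < k) {V : ℝ → ℝ} {y : (ℝ → ℝ) × (ℝ → ℝ)}
    {s : Set ℝ} (h : SolvesOn V k y.1 y.2 s) {x : ℝ} (hx : x ∈ s) :
    HasDerivAt (amplitude k y)
      (-Complex.I / k * Complex.exp (-(Complex.I * k * x)) * V x * y.1 x) x := by
  have hk' : (k : ℂ) ≠ 0 := by exact_mod_cast hk.ne'
  obtain ⟨h1, h2⟩ := h x hx
  have h3 : HasDerivAt (fun x : ℝ => Complex.exp (-(Complex.I * k * x)))
      (Complex.exp (-(Complex.I * k * x)) * -(Complex.I * k * 1)) x :=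
    (((hasDerivAt_id x).ofReal_comp.const_mul (Complex.I * k)).neg).cexp
  have h4 := (h1.ofReal_comp.sub
    ((h2.ofReal_comp.const_mul Complex.I).div_const (k : ℂ))).mul h3
  convert! h4 using 1
  push_cast
  simp only [Pi.sub_apply]
  field_simp
  linear_combination (-(y.2 x : ℂ) * k) * Complex.I_sq

theorem fst_eq_amplitude (k : ℝ) (y : (ℝ → ℝ) × (ℝ → ℝ)) (x : ℝ) :
    (y.1 x : ℂ) = (amplitude k y x * Complex.exp (Complex.I * k * x)
      + conj (amplitude k y x) * Complex.exp (-(Complex.I * k * x))) / 2 := by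
  have h : Complex.exp (-(Complex.I * k * x)) * Complex.exp (Complex.I * k * x) = 1 := by
    rw [← Complex.exp_add]; simp
  have h' : conj (Complex.exp (-(Complex.I * k * x))) = Complex.exp (Complex.I * k * x) := by
    rw [← Complex.exp_conj]; simp
  simp only [amplitude, map_mul, map_sub, map_div₀, Complex.conj_ofReal, Complex.conj_I, h']
  linear_combination (-(y.1 x : ℂ)) * h

theorem hasDerivAt_shellBump_scaled (D L x : ℝ) :
    HasDerivAt (fun x => D / L * shellBump (x / L)) (D / L ^ 2 * deriv shellBump (x / L)) x := by
  have h : HasDerivAt shellBump (deriv shellBump (x / L)) (x / L) :=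
    ((contDiff_shellBump.differentiable (by norm_num)) _).hasDerivAt
  convert! (h.comp x ((hasDerivAt_id x).div_const L)).const_mul (D / L) using 1
  ring

/-- The averaging estimate on a shell `[L, 2L]`: the oscillating terms contribute `O(1/L)`. -/
theorem exists_shell_averaging {D M η : ℝ} (hD : 0 < D) (hM : 0 ≤ M) (hη : 0 ≤ η) :
    ∃ C : ℝ, 0 ≤ C ∧ ∀ (L : ℝ) (Z R α β A B : ℝ → ℂ) (ζ : ℂ), 0 < L →
      (∀ x, ‖α x‖ ≤ M) → (∀ x, ‖β x‖ ≤ M) →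
      (∀ x, HasDerivAt A (α x) x) → (∀ x, HasDerivAt B (β x) x) →
      (∀ x, ‖A x‖ ≤ η) → (∀ x, ‖B x‖ ≤ η) → ‖ζ‖ ≤ 1 →
      (∀ x ∈ Icc L (2 * L), HasDerivAt Z
        ((D / L * shellBump (x / L) : ℝ) * (-ζ * conj (Z x) + α x * Z x + β x * conj (Z x))) x) →
      (∀ x ∈ Icc L (2 * L), HasDerivAt R
        ((D / L * shellBump (x / L) : ℝ) * (-ζ * conj (R x))) x) → R L = Z L →
      ∀ x ∈ Icc L (2 * L), ‖Z x - R x‖ ≤ C / L * ‖Z L‖ := by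
  obtain ⟨H, hH, hbump⟩ := exists_shellBump_bound
  refine ⟨2 * η * Real.exp ((1 + 2 * M) * (D * H)) *
    ((D * H + (2 + 2 * M) * (D * H) ^ 2) * Real.exp (D * H) + D * H), by positivity, ?_⟩
  intro L Z R α β A B ζ hL hα hβ hA hB hA' hB' hζ hZ hR hRL x hx
  have key := norm_sub_le_of_oscillating (p := fun x => D / L * shellBump (x / L))
    (p' := fun x => D / L ^ 2 * deriv shellBump (x / L)) (a := L) (b := 2 * L)
    (P := D * H / L) (P' := D * H / L ^ 2) (η := η) (M := M) (ζ := ζ)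
    (Z := Z) (R := R) (α := α) (β := β) (A := A) (B := B)
    (by linarith) hM (fun x _ => hasDerivAt_shellBump_scaled D L x)
    (by simp [div_self hL.ne', shellBump_of_le_one])
    (fun x _ => by
      rw [abs_mul, abs_of_pos (div_pos hD hL), mul_div_right_comm]
      exact mul_le_mul_of_nonneg_left (hbump _).1 (by positivity))
    (fun x _ => by
      rw [abs_mul, abs_of_pos (by positivity : 0 < D / L ^ 2), mul_div_right_comm]
      exact mul_le_mul_of_nonneg_left (hbump _).2 (by positivity))
    (fun x _ => hα x) (fun x _ => hβ x) (fun x _ => hA x) (fun x _ => hB x)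
    (fun x _ => hA' x) (fun x _ => hB' x) hζ hZ hR hRL x hx
  refine key.trans (le_of_eq ?_)
  have e1 : (1 + 2 * M) * (D * H / L) * (2 * L - L) = (1 + 2 * M) * (D * H) := by
    field_simp; ring
  have e2 : D * H / L * (2 * L - L) = D * H := by field_simp; ring
  rw [e1, e2]
  field_simp
  ring

theorem hasDerivAt_exp_div {w : ℝ} (hw : w ≠ 0) (d : ℂ) (x : ℝ) :
    HasDerivAt (fun x : ℝ => d * Complex.exp (Complex.I * w * x) / (Complex.I * w))
      (d * Complex.exp (Complex.I * w * x)) x := by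
  have hw' : (w : ℂ) ≠ 0 := by exact_mod_cast hw
  have h := ((((hasDerivAt_id x).ofReal_comp.const_mul (Complex.I * w)).cexp).const_mul d).div_const
    (Complex.I * w)
  convert! h using 1
  field_simp [Complex.I_ne_zero]
  simp

theorem norm_mul_exp (w : ℝ) (d : ℂ) (x : ℝ) :
    ‖d * Complex.exp (Complex.I * w * x)‖ = ‖d‖ := by
  have : Complex.I * w * x = ((w * x : ℝ) : ℂ) * Complex.I := by push_cast; ring
  rw [norm_mul, this, Complex.norm_exp_ofReal_mul_I, mul_one]

theorem norm_mul_exp_div (w : ℝ) (d : ℂ) (x : ℝ) :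
    ‖d * Complex.exp (Complex.I * w * x) / (Complex.I * w)‖ = ‖d‖ / |w| := by
  rw [norm_div, norm_mul_exp, norm_mul, Complex.norm_I, one_mul, Complex.norm_real, Real.norm_eq_abs]

/-- The potential of a shell of radius `L` on the positive half-line: frequency `2k`, phase given by
the complex number `c`, and strength `D`. -/
noncomputable def halfShell (k D L : ℝ) (c : ℂ) (x : ℝ) : ℝ :=
  4 * k * (D / L * shellBump (x / L)) * (c * Complex.exp (2 * Complex.I * k * x)).re

theorem halfShell_eq (k D L : ℝ) (c : ℂ) (x : ℝ) :
    (halfShell k D L c x : ℂ) = 2 * k * (D / L * shellBump (x / L) : ℝ) *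
      (c * Complex.exp (Complex.I * (2 * k : ℝ) * x)
        + conj c * Complex.exp (Complex.I * (-(2 * k) : ℝ) * x)) := by
  have h := Complex.re_eq_add_conj (c * Complex.exp (2 * Complex.I * k * x))
  have h' : conj (Complex.exp (2 * Complex.I * k * x))
      = Complex.exp (Complex.I * (-(2 * k) : ℝ) * x) := by
    rw [← Complex.exp_conj]
    simp only [map_mul, map_ofNat, Complex.conj_I, Complex.conj_ofReal]
    congr 1; push_cast; ring
  have h'' : Complex.exp (2 * Complex.I * k * x) = Complex.exp (Complex.I * (2 * k : ℝ) * x) := by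
    congr 1; push_cast; ring
  rw [map_mul, h', h''] at h
  rw [halfShell, Complex.ofReal_mul, ← h'', h'', h]
  push_cast
  ring

/-- The equation for the amplitude at energy `μ²` in a shell of frequency `2k`. -/
theorem amplitude_deriv_eq (k D L : ℝ) {μ : ℝ} (c : ℂ) (y : (ℝ → ℝ) × (ℝ → ℝ)) (x : ℝ) :
    -Complex.I / μ * Complex.exp (-(Complex.I * μ * x)) * halfShell k D L c x * y.1 x =
      (D / L * shellBump (x / L) : ℝ) *
        (((-Complex.I * (k / μ) * c) * Complex.exp (Complex.I * (2 * k : ℝ) * x)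
          + (-Complex.I * (k / μ) * conj c) * Complex.exp (Complex.I * (-(2 * k) : ℝ) * x))
            * amplitude μ y x
        + ((-Complex.I * (k / μ) * c) * Complex.exp (Complex.I * (2 * (k - μ) : ℝ) * x)
          + (-Complex.I * (k / μ) * conj c) * Complex.exp (Complex.I * (-(2 * (k + μ)) : ℝ) * x))
            * conj (amplitude μ y x)) := by
  rw [fst_eq_amplitude μ y x, halfShell_eq]
  have e1 : Complex.exp (-(Complex.I * μ * x)) * Complex.exp (Complex.I * μ * x) = 1 := by
    rw [← Complex.exp_add]; simp
  have e2 : Complex.exp (Complex.I * (2 * (k - μ) : ℝ) * x)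
      = Complex.exp (Complex.I * (2 * k : ℝ) * x) * Complex.exp (-(Complex.I * μ * x))
        * Complex.exp (-(Complex.I * μ * x)) := by
    rw [← Complex.exp_add, ← Complex.exp_add]; congr 1; push_cast; ring
  have e3 : Complex.exp (Complex.I * (-(2 * (k + μ)) : ℝ) * x)
      = Complex.exp (Complex.I * (-(2 * k) : ℝ) * x) * Complex.exp (-(Complex.I * μ * x))
        * Complex.exp (-(Complex.I * μ * x)) := by
    rw [← Complex.exp_add, ← Complex.exp_add]; congr 1; push_cast; ring
  rw [e2, e3]
  linear_combination (-Complex.I / μ * k * (D / L * shellBump (x / L) : ℝ) *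
    (c * Complex.exp (Complex.I * (2 * k : ℝ) * x)
      + conj c * Complex.exp (Complex.I * (-(2 * k) : ℝ) * x)) * amplitude μ y x) * e1

/-- Off resonance, a shell of large radius hardly changes the amplitude. -/
theorem exists_shell_nonresonant {k μ D : ℝ} (hk : 0 < k) (hμ : 0 < μ) (hD : 0 < D)
    (hne : k ≠ μ) :
    ∃ C : ℝ, 0 ≤ C ∧ ∀ (L : ℝ) (c : ℂ) (V : ℝ → ℝ) (y : (ℝ → ℝ) × (ℝ → ℝ)), 0 < L → ‖c‖ ≤ 1 →
      SolvesOn V μ y.1 y.2 (Icc L (2 * L)) →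
      (∀ x ∈ Icc L (2 * L), V x = halfShell k D L c x) →
      ∀ x ∈ Icc L (2 * L), ‖amplitude μ y x - amplitude μ y L‖ ≤ C / L * ‖amplitude μ y L‖ := by
  have w1 : 2 * k ≠ 0 := by positivity
  have w2 : -(2 * k) ≠ 0 := neg_ne_zero.2 w1
  have w3 : 2 * (k - μ) ≠ 0 := mul_ne_zero two_ne_zero (sub_ne_zero.2 hne)
  have w4 : -(2 * (k + μ)) ≠ 0 := neg_ne_zero.2 (by positivity)
  obtain ⟨C, hC, key⟩ := exists_shell_averaging (M := k / μ + k / μ)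
    (η := k / μ / |2 * k| + k / μ / |-(2 * k)|
      + (k / μ / |2 * (k - μ)| + k / μ / |-(2 * (k + μ))|)) hD (by positivity) (by positivity)
  refine ⟨C, hC, fun L c V y hL hc hy hV x hx => ?_⟩
  have hd : ‖-Complex.I * (k / μ) * c‖ ≤ k / μ := by
    rw [norm_mul, norm_mul, norm_neg, Complex.norm_I, one_mul, ← Complex.ofReal_div,
      Complex.norm_real, Real.norm_of_nonneg (by positivity)]
    exact mul_le_of_le_one_right (by positivity) hc
  have hd' : ‖-Complex.I * (k / μ) * conj c‖ ≤ k / μ := by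
    rw [norm_mul, RCLike.norm_conj, ← norm_mul]; exact hd
  refine key L (amplitude μ y) (fun _ => amplitude μ y L) _ _ _ _ 0 hL
    (fun x => (norm_add_le _ _).trans ?_) (fun x => (norm_add_le _ _).trans ?_)
    (fun x => (hasDerivAt_exp_div w1 (-Complex.I * (k / μ) * c) x).add
      (hasDerivAt_exp_div w2 (-Complex.I * (k / μ) * conj c) x))
    (fun x => (hasDerivAt_exp_div w3 (-Complex.I * (k / μ) * c) x).add
      (hasDerivAt_exp_div w4 (-Complex.I * (k / μ) * conj c) x))
    (fun x => ((norm_add_le _ _).trans ?_).trans (le_add_of_nonneg_right (by positivity)))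
    (fun x => ((norm_add_le _ _).trans ?_).trans (le_add_of_nonneg_left (by positivity)))
    (by simp) (fun x hx => ?_) (fun x _ => ?_) rfl x hx
  · rw [norm_mul_exp, norm_mul_exp]; gcongr
  · rw [norm_mul_exp, norm_mul_exp]; gcongr
  · rw [norm_mul_exp_div, norm_mul_exp_div]; gcongr
  · rw [norm_mul_exp_div, norm_mul_exp_div]; gcongr
  · have h := hasDerivAt_amplitude hμ hy hx
    rw [hV x hx, amplitude_deriv_eq] at h
    simpa using! h
  · simpa using! hasDerivAt_const x (amplitude μ y L)

/-- At resonance, with the phase `c` adapted to the amplitude at the inner radius, the amplitude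
follows the decaying solution `e^{-D h}` of the averaged equation. -/
theorem exists_shell_resonant {k D : ℝ} (hk : 0 < k) (hD : 0 < D) :
    ∃ C : ℝ, 0 ≤ C ∧ ∀ (L : ℝ) (c : ℂ) (V : ℝ → ℝ) (y : (ℝ → ℝ) × (ℝ → ℝ)), 0 < L → ‖c‖ ≤ 1 →
      Complex.I * c * conj (amplitude k y L) = amplitude k y L →
      SolvesOn V k y.1 y.2 (Icc L (2 * L)) →
      (∀ x ∈ Icc L (2 * L), V x = halfShell k D L c x) →
      ∀ x ∈ Icc L (2 * L),
        ‖amplitude k y x - Real.exp (-(D * Real.smoothTransition (x / L - 1))) * amplitude k y L‖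
          ≤ C / L * ‖amplitude k y L‖ := by
  have hk' : (k : ℂ) ≠ 0 := by exact_mod_cast hk.ne'
  have w1 : 2 * k ≠ 0 := by positivity
  have w2 : -(2 * k) ≠ 0 := neg_ne_zero.2 w1
  have w4 : -(2 * (k + k)) ≠ 0 := neg_ne_zero.2 (by positivity)
  obtain ⟨C, hC, key⟩ := exists_shell_averaging (M := 1 + 1)
    (η := 1 / |2 * k| + 1 / |-(2 * k)| + 1 / |-(2 * (k + k))|) hD (by positivity) (by positivity)
  refine ⟨C, hC, fun L c V y hL hc hphase hy hV x hx => ?_⟩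
  have hd : ‖-Complex.I * c‖ ≤ 1 := by simpa using hc
  have hd' : ‖-Complex.I * conj c‖ ≤ 1 := by simpa using hc
  refine key L (amplitude k y)
    (fun x => Real.exp (-(D * Real.smoothTransition (x / L - 1))) * amplitude k y L)
    _ _ _ _ (Complex.I * c) hL
    (fun x => (norm_add_le _ _).trans ?_) (fun x => ?_)
    (fun x => (hasDerivAt_exp_div w1 (-Complex.I * c) x).add
      (hasDerivAt_exp_div w2 (-Complex.I * conj c) x))
    (fun x => hasDerivAt_exp_div w4 (-Complex.I * conj c) x)
    (fun x => ((norm_add_le _ _).trans ?_).trans (le_add_of_nonneg_right (by positivity)))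
    (fun x => ?_)
    (by simpa using hc) (fun x hx => ?_) (fun x _ => ?_) ?_ x hx
  · rw [norm_mul_exp, norm_mul_exp]; gcongr
  · rw [norm_mul_exp]; linarith
  · rw [norm_mul_exp_div, norm_mul_exp_div]; gcongr
  · rw [norm_mul_exp_div]
    refine le_trans ?_ (le_add_of_nonneg_left (by positivity))
    gcongr
  · have h := hasDerivAt_amplitude hk hy hx
    rw [hV x hx, amplitude_deriv_eq, div_self hk'] at h
    have h0 : Complex.exp (Complex.I * (2 * (k - k) : ℝ) * x) = 1 := by simp
    rw [h0] at h
    refine h.congr_deriv ?_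
    ring
  · have h1 : HasDerivAt (fun x => Real.exp (-(D * Real.smoothTransition (x / L - 1))))
        (Real.exp (-(D * Real.smoothTransition (x / L - 1))) * -(D * (shellBump (x / L) * (1 / L))))
        x := by
      have h0 : HasDerivAt (fun x => Real.smoothTransition (x / L - 1))
          (shellBump (x / L) * (1 / L)) x := by
        have g : HasDerivAt (fun x : ℝ => x / L - 1) (1 / L) x :=
          ((hasDerivAt_id x).div_const L).sub_const 1
        exact (hasDerivAt_smoothTransition (x / L - 1)).comp x g
      exact ((h0.const_mul D).neg).exp
    have h2 := h1.ofReal_comp.mul_const (amplitude k y L)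
    convert! h2 using 1
    rw [map_mul, Complex.conj_ofReal]
    push_cast
    linear_combination (-(D / L * shellBump (x / L) *
      Complex.exp (-(D * Real.smoothTransition (x / L - 1))) : ℂ)) * hphase
  · simp [div_self hL.ne']

/-- Where the potential vanishes, the amplitude is constant. -/
theorem amplitude_eq_of_free {k a b : ℝ} (hk : 0 < k) {V : ℝ → ℝ} {y : (ℝ → ℝ) × (ℝ → ℝ)}
    (hy : SolvesOn V k y.1 y.2 (Icc a b)) (hV : ∀ x ∈ Icc a b, V x = 0) :
    ∀ x ∈ Icc a b, amplitude k y x = amplitude k y a := by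
  refine constant_of_has_deriv_right_zero
    (fun x hx => (hasDerivAt_amplitude hk hy hx).continuousAt.continuousWithinAt) fun x hx => ?_
  have hx' := Ico_subset_Icc_self hx
  have h := (hasDerivAt_amplitude hk hy hx').hasDerivWithinAt (s := Ici x)
  rw [hV x hx'] at h
  simpa using! h

end Shell

/-! ### The schedule of frequencies -/

section Schedule

open Set
open scoped ComplexConjugate

/-- The index served in shell `j`, one more than the exponent of `2` in `j + 1`. Every index recurs
with bounded gaps. -/
noncomputable def visit (j : ℕ) : ℕ+ := Nat.succPNat (padicValNat 2 (j + 1))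

/-- A bound for the gaps between the shells that serve `m`. -/
def period (m : ℕ+) : ℕ := 2 ^ ((m : ℕ) + 1)

theorem period_pos (m : ℕ+) : 0 < period m := by unfold period; positivity

theorem exists_visit_eq (m : ℕ+) (j : ℕ) : ∃ i, j ≤ i ∧ i < j + period m ∧ visit i = m := by
  obtain ⟨r, hr⟩ : ∃ r, (m : ℕ) = r + 1 := ⟨m.natPred, (PNat.natPred_add_one m).symm⟩
  set q := j / 2 ^ (r + 1) + 1 with hq
  have h1 : 2 ^ (r + 1) * (j / 2 ^ (r + 1)) ≤ j := Nat.mul_div_le _ _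
  have h2 : j < 2 ^ (r + 1) * (j / 2 ^ (r + 1)) + 2 ^ (r + 1) :=
    Nat.lt_mul_div_succ j (by positivity)
  have h3 : 2 ^ r * (2 * q + 1) = 2 ^ (r + 1) * (j / 2 ^ (r + 1)) + 2 ^ (r + 1) + 2 ^ r := by
    rw [hq]; ring
  have h4 : 0 < 2 ^ r := by positivity
  have h5 : 2 ^ (r + 1) = 2 * 2 ^ r := by ring
  have h6 : period m = 4 * 2 ^ r := by rw [period, hr]; ring
  refine ⟨2 ^ r * (2 * q + 1) - 1, by omega, by omega, ?_⟩
  have h7 : 2 ^ r * (2 * q + 1) - 1 + 1 = 2 ^ r * (2 * q + 1) := by omega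
  have h8 : padicValNat 2 (2 ^ r * (2 * q + 1)) = r := by
    rw [padicValNat.mul (by positivity) (by positivity), padicValNat.prime_pow,
      padicValNat.eq_zero_of_not_dvd (by omega), add_zero]
  apply PNat.eq
  rw [visit, h7, h8, Nat.succPNat_coe, hr]

/-- A sequence that at most doubles, but shrinks by `2 / 8 ^ P` at least once in any `P` consecutive
steps, decays like `4 ^ (-j)`. -/
theorem exists_bound_of_recurrent_decay {ρ : ℕ → ℝ} (hρ : ∀ j, 0 ≤ ρ j) {J P : ℕ} (hP : 0 < P)
    (hgrow : ∀ j, J ≤ j → ρ (j + 1) ≤ 2 * ρ j)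
    (hdecay : ∀ j, J ≤ j → ∃ i, j ≤ i ∧ i < j + P ∧ ρ (i + 1) ≤ 2 * ((8 : ℝ) ^ P)⁻¹ * ρ i) :
    ∃ C, ∀ j, J ≤ j → 4 ^ j * ρ j ≤ C := by
  have hiter : ∀ d j, J ≤ j → ρ (j + d) ≤ 2 ^ d * ρ j := by
    intro d
    induction d with
    | zero => intro j _; simp
    | succ d ih =>
      intro j hj
      calc ρ (j + d + 1) ≤ 2 * ρ (j + d) := hgrow _ (by omega)
        _ ≤ 2 * (2 ^ d * ρ j) := by gcongr; exact ih j hj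
        _ = _ := by ring
  have hper : ∀ j, J ≤ j → 4 ^ (j + P) * ρ (j + P) ≤ 4 ^ j * ρ j := by
    intro j hj
    obtain ⟨i, hji, hiP, hi⟩ := hdecay j hj
    obtain ⟨a, rfl⟩ := Nat.exists_eq_add_of_le hji
    obtain ⟨b, hb⟩ := Nat.exists_eq_add_of_lt hiP
    have e : ρ (j + P) ≤ 2 ^ P * ((8 : ℝ) ^ P)⁻¹ * ρ j := by
      have hPab : P = a + b + 1 := by omega
      calc ρ (j + P) = ρ (j + a + 1 + b) := by congr 1; omega
        _ ≤ 2 ^ b * ρ (j + a + 1) := hiter b _ (by omega)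
        _ ≤ 2 ^ b * (2 * ((8 : ℝ) ^ P)⁻¹ * ρ (j + a)) := by gcongr
        _ ≤ 2 ^ b * (2 * ((8 : ℝ) ^ P)⁻¹ * (2 ^ a * ρ j)) := by gcongr; exact hiter a j hj
        _ = 2 ^ (a + b + 1) * ((8 : ℝ) ^ P)⁻¹ * ρ j := by ring
        _ = _ := by rw [← hPab]
    have h8 : (4 : ℝ) ^ P * 2 ^ P * ((8 : ℝ) ^ P)⁻¹ = 1 := by
      rw [← mul_pow]; norm_num
    calc (4 : ℝ) ^ (j + P) * ρ (j + P) ≤ 4 ^ (j + P) * (2 ^ P * ((8 : ℝ) ^ P)⁻¹ * ρ j) := by gcongr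
      _ = 4 ^ j * ρ j * (4 ^ P * 2 ^ P * ((8 : ℝ) ^ P)⁻¹) := by ring
      _ = _ := by rw [h8, mul_one]
  refine ⟨∑ i ∈ Finset.range (J + P), 4 ^ i * ρ i, fun j => ?_⟩
  induction j using Nat.strong_induction_on with
  | _ j ih =>
    intro hj
    by_cases hjP : j < J + P
    · exact Finset.single_le_sum (f := fun i => 4 ^ i * ρ i)
        (fun i _ => mul_nonneg (by positivity) (hρ i)) (Finset.mem_range.2 hjP)
    · obtain ⟨i, rfl⟩ := Nat.exists_eq_add_of_le' (show P ≤ j by omega)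
      exact (hper i (by omega)).trans (ih i (by omega) (by omega))

/-- The strength of the shells that serve `m`: the gain `e^{-D} = 8^{-P}` of one visit outweighs the
possible doubling in the other shells of a period. -/
noncomputable def strength (m : ℕ+) : ℝ := period m * Real.log 8

theorem strength_pos (m : ℕ+) : 0 < strength m :=
  mul_pos (by exact_mod_cast period_pos m) (Real.log_pos (by norm_num))

theorem exp_neg_strength (m : ℕ+) : Real.exp (-strength m) = ((8 : ℝ) ^ period m)⁻¹ := by
  rw [Real.exp_neg, strength, mul_comm, Real.exp_mul, Real.exp_log (by norm_num), Real.rpow_natCast]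

/-- A shell of frequency `2k`, strength `D` and radius `2 ^ j` at most doubles the amplitude of the
solutions at energy `μ ^ 2`, and shrinks it by `2 e^{-D}` if `μ = k` and the phase is adapted. -/
def ShellControl (k μ D : ℝ) (j : ℕ) : Prop :=
  ∀ (c : ℂ) (V : ℝ → ℝ) (y : (ℝ → ℝ) × (ℝ → ℝ)), ‖c‖ ≤ 1 →
    (k = μ → Complex.I * c * conj (amplitude μ y (2 ^ j)) = amplitude μ y (2 ^ j)) →
    SolvesOn V μ y.1 y.2 (Icc (2 ^ j) (2 * 2 ^ j)) →
    (∀ x ∈ Icc ((2 : ℝ) ^ j) (2 * 2 ^ j), V x = halfShell k D (2 ^ j) c x) →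
    (∀ x ∈ Icc ((2 : ℝ) ^ j) (2 * 2 ^ j), ‖amplitude μ y x‖ ≤ 2 * ‖amplitude μ y (2 ^ j)‖) ∧
    (k = μ → ‖amplitude μ y (2 * 2 ^ j)‖ ≤ 2 * Real.exp (-D) * ‖amplitude μ y (2 ^ j)‖)

theorem exists_div_two_pow_le (C : ℝ) {ε : ℝ} (hε : 0 < ε) :
    ∃ J : ℕ, ∀ j, J ≤ j → C / 2 ^ j ≤ ε := by
  have h : Filter.Tendsto (fun j : ℕ => C / (2 : ℝ) ^ j) Filter.atTop (nhds 0) :=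
    tendsto_const_nhds.div_atTop (tendsto_pow_atTop_atTop_of_one_lt (by norm_num))
  exact Filter.eventually_atTop.1 ((h.eventually_lt_const hε).mono fun _ => le_of_lt)

theorem exists_shellControl {k μ D : ℝ} (hk : 0 < k) (hμ : 0 < μ) (hD : 0 < D) :
    ∃ J : ℕ, ∀ j, J ≤ j → ShellControl k μ D j := by
  by_cases hkμ : k = μ
  · subst hkμ
    obtain ⟨C, hC, key⟩ := exists_shell_resonant hk hD
    obtain ⟨J, hJ⟩ := exists_div_two_pow_le C (Real.exp_pos (-D))
    refine ⟨J, fun j hj c V y hc hphase hy hV => ?_⟩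
    have hL : (0 : ℝ) < 2 ^ j := by positivity
    have h := key (2 ^ j) c V y hL hc (hphase rfl) hy hV
    have hCj := hJ j hj
    set Z := amplitude k y
    have hbound : ∀ x ∈ Icc ((2 : ℝ) ^ j) (2 * 2 ^ j), ‖Z x‖ ≤
        (Real.exp (-D) + Real.exp (-(D * Real.smoothTransition (x / 2 ^ j - 1)))) *
          ‖Z (2 ^ j)‖ := by
      intro x hx
      have h1 := norm_le_norm_sub_add (Z x)
        (Real.exp (-(D * Real.smoothTransition (x / 2 ^ j - 1))) * Z (2 ^ j))
      rw [norm_mul, Complex.norm_real, Real.norm_of_nonneg (Real.exp_pos _).le] at h1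
      have h2 := h x hx
      have h3 : C / 2 ^ j * ‖Z (2 ^ j)‖ ≤ Real.exp (-D) * ‖Z (2 ^ j)‖ := by gcongr
      linarith
    refine ⟨fun x hx => (hbound x hx).trans ?_, fun _ => ?_⟩
    · gcongr
      have h1 : Real.exp (-D) ≤ 1 := Real.exp_le_one_iff.2 (by linarith)
      have h2 : Real.exp (-(D * Real.smoothTransition (x / 2 ^ j - 1))) ≤ 1 :=
        Real.exp_le_one_iff.2 (neg_nonpos.2 (mul_nonneg hD.le (Real.smoothTransition.nonneg _)))
      linarith
    · have h1 := hbound (2 * 2 ^ j) ⟨by linarith, le_rfl⟩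
      have h2 : (2 : ℝ) * 2 ^ j / 2 ^ j - 1 = 1 := by field_simp; norm_num
      rw [h2, Real.smoothTransition.one, mul_one] at h1
      linarith
  · obtain ⟨C, hC, key⟩ := exists_shell_nonresonant hk hμ hD hkμ
    obtain ⟨J, hJ⟩ := exists_div_two_pow_le C one_pos
    refine ⟨J, fun j hj c V y hc _ hy hV => ⟨fun x hx => ?_, fun h => absurd h hkμ⟩⟩
    have h := key (2 ^ j) c V y (by positivity) hc hy hV x hx
    have h1 := norm_le_norm_sub_add (amplitude μ y x) (amplitude μ y (2 ^ j))
    have h3 : C / 2 ^ j * ‖amplitude μ y (2 ^ j)‖ ≤ 1 * ‖amplitude μ y (2 ^ j)‖ := by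
      gcongr
      exact hJ j hj
    linarith

/-- Shells serving `n` are switched on from radius `2 ^ gate n` on. Then their amplitudes are small,
and for each `m` all but finitely many shells are under control, uniformly in the index `n`
they serve: for `n < m` this excludes finitely many `j` for each of finitely many `n`, and for
`m ≤ n` it is built into `gate n`. -/
theorem exists_gate {κ : ℕ+ → ℝ} (hκ : ∀ n, 0 < κ n) :
    ∃ gate : ℕ+ → ℕ,
      (∀ n j, gate n ≤ j → 4 * κ n * strength n / 2 ^ j ≤ Real.exp (-(n + κ n)) * (3 / 4) ^ j) ∧
      ∀ m, ∃ J, gate m ≤ J ∧ ∀ n j, J ≤ j → gate n ≤ j →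
        ShellControl (κ n) (κ m) (strength n) j := by
  choose J hJ using fun n m => exists_shellControl (hκ n) (hκ m) (strength_pos n)
  have hsmall : ∀ n : ℕ+, ∃ A : ℕ, ∀ j, A ≤ j →
      4 * κ n * strength n / 2 ^ j ≤ Real.exp (-(n + κ n)) * (3 / 4) ^ j := by
    intro n
    have h : Filter.Tendsto (fun j : ℕ => 4 * κ n * strength n / (3 / 2 : ℝ) ^ j) Filter.atTop
        (nhds 0) :=
      tendsto_const_nhds.div_atTop (tendsto_pow_atTop_atTop_of_one_lt (by norm_num))
    obtain ⟨A, hA⟩ := Filter.eventually_atTop.1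
      (h.eventually_lt_const (Real.exp_pos (-(n + κ n))))
    refine ⟨A, fun j hj => ?_⟩
    -- A part `(3 / 4) ^ j` of the decay is kept for summation over `j`.
    have e : (2 : ℝ) ^ j = (3 / 2) ^ j * (3 / 4 : ℝ)⁻¹ ^ j := by rw [← mul_pow]; norm_num
    have h1 := (hA j hj).le
    rw [e, inv_pow, ← div_div, div_inv_eq_mul]
    gcongr
  choose A hA using hsmall
  refine ⟨fun n => max (A n) ((Finset.Icc 1 n).sup (J n)), fun n j hj => hA n j (by
    exact (le_max_left _ _).trans hj), fun m => ?_⟩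
  refine ⟨max (max (A m) ((Finset.Icc 1 m).sup (J m))) ((Finset.Icc 1 m).sup fun n => J n m),
    le_max_left _ _, fun n j hj hn => hJ n m j ?_⟩
  rcases le_total n m with h | h
  · have : J n m ≤ (Finset.Icc 1 m).sup fun n => J n m :=
      Finset.le_sup (f := fun n => J n m) (Finset.mem_Icc.2 ⟨one_le, h⟩)
    exact this.trans ((le_max_right _ _).trans hj)
  · have : J n m ≤ (Finset.Icc 1 n).sup (J n) :=
      Finset.le_sup (f := J n) (Finset.mem_Icc.2 ⟨one_le, h⟩)
    exact this.trans ((le_max_right _ _).trans hn)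

end Schedule

/-! ### The potential -/

section Potential

open Set
open scoped ComplexConjugate

/-- The coefficient of `e^{2ikx}` in the even extension of a shell to `ℝ`. -/
noncomputable def envelope (k D L : ℝ) (c : ℂ) (x : ℝ) : ℂ :=
  (2 * k * D / L : ℝ) * (c * shellBump (L⁻¹ * x) + conj c * shellBump (-L⁻¹ * x))

/-- The even extension of `halfShell`. -/
noncomputable def shell (k D L : ℝ) (c : ℂ) (x : ℝ) : ℝ :=
  2 * (envelope k D L c x * Complex.exp (2 * Complex.I * k * x)).re

theorem envelope_neg (k D L : ℝ) (c : ℂ) (x : ℝ) :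
    envelope k D L c (-x) = conj (envelope k D L c x) := by
  simp only [envelope, map_mul, map_add, Complex.conj_ofReal, Complex.conj_conj, neg_mul, mul_neg,
    neg_neg]
  ring

theorem conj_envelope (k D L : ℝ) (c : ℂ) (x : ℝ) :
    conj (envelope k D L c x) = envelope k D L (conj c) x := by
  simp only [envelope, map_mul, map_add, Complex.conj_ofReal]

theorem envelope_eq_zero (k D : ℝ) {L : ℝ} (c : ℂ) {x : ℝ} (hL : 0 < L)
    (hx : |x| ≤ L ∨ 2 * L ≤ |x|) : envelope k D L c x = 0 := by
  have key : ∀ z : ℝ, z ≤ L ∨ 2 * L ≤ z → shellBump (L⁻¹ * z) = 0 := by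
    rintro z (hz | hz)
    · exact shellBump_of_le_one (by rw [inv_mul_le_iff₀ hL]; linarith)
    · exact shellBump_of_two_le (by rw [le_inv_mul_iff₀ hL]; linarith)
  have h1 : shellBump (L⁻¹ * x) = 0 := by
    refine key x ?_
    rcases hx with hx | hx
    · exact Or.inl ((le_abs_self x).trans hx)
    · rcases le_total 0 x with h | h
      · exact Or.inr (by rwa [abs_of_nonneg h] at hx)
      · exact Or.inl (by linarith)
  have h2 : shellBump (-L⁻¹ * x) = 0 := by
    rw [neg_mul_comm]
    refine key (-x) ?_
    rcases hx with hx | hx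
    · exact Or.inl ((neg_le_abs x).trans hx)
    · rcases le_total 0 x with h | h
      · exact Or.inl (by linarith)
      · exact Or.inr (by rwa [abs_of_nonpos h] at hx)
  rw [envelope, h1, h2]
  simp

theorem contDiff_envelope (k D L : ℝ) (c : ℂ) : ContDiff ℝ ∞ (envelope k D L c) := by
  have h : ∀ b : ℝ, ContDiff ℝ ∞ fun x : ℝ => ((shellBump (b * x) : ℝ) : ℂ) := fun b =>
    Complex.ofRealCLM.contDiff.comp (contDiff_shellBump.comp (contDiff_const.mul contDiff_id))
  exact contDiff_const.mul ((contDiff_const.mul (h _)).add (contDiff_const.mul (h _)))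

theorem shell_eq_zero (k D : ℝ) {L : ℝ} (c : ℂ) {x : ℝ} (hL : 0 < L)
    (hx : |x| ≤ L ∨ 2 * L ≤ |x|) : shell k D L c x = 0 := by
  simp [shell, envelope_eq_zero k D c hL hx]

theorem ofReal_shell (k D L : ℝ) (c : ℂ) (x : ℝ) :
    (shell k D L c x : ℂ) = Complex.exp (2 * Complex.I * k * x) * envelope k D L c x
      + Complex.exp (-(2 * Complex.I * k * x)) * conj (envelope k D L c x) := by
  have h := Complex.re_eq_add_conj (envelope k D L c x * Complex.exp (2 * Complex.I * k * x))
  have h' : conj (Complex.exp (2 * Complex.I * k * x))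
      = Complex.exp (-(2 * Complex.I * k * x)) := by
    rw [← Complex.exp_conj]
    simp only [map_mul, map_ofNat, Complex.conj_I, Complex.conj_ofReal]
    congr 1; ring
  rw [map_mul, h'] at h
  rw [shell, Complex.ofReal_mul, h]
  push_cast
  ring

theorem shell_neg (k D L : ℝ) (c : ℂ) (x : ℝ) : shell k D L c (-x) = shell k D L c x := by
  apply Complex.ofReal_injective
  rw [ofReal_shell, ofReal_shell, envelope_neg, Complex.conj_conj]
  push_cast
  simp only [mul_neg, neg_neg]
  ring

theorem contDiff_shell (k D L : ℝ) (c : ℂ) : ContDiff ℝ ∞ (shell k D L c) := by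
  have h : ContDiff ℝ ∞ fun x : ℝ => Complex.exp (2 * Complex.I * k * x) :=
    (contDiff_const.mul Complex.ofRealCLM.contDiff).cexp
  exact contDiff_const.mul (Complex.reCLM.contDiff.comp ((contDiff_envelope k D L c).mul h))

theorem shell_eq_halfShell (k D : ℝ) {L : ℝ} (c : ℂ) {x : ℝ} (hL : 0 < L) (hx : 0 ≤ x) :
    shell k D L c x = halfShell k D L c x := by
  have h : shellBump (-L⁻¹ * x) = 0 := shellBump_of_le_one (by
    have : 0 ≤ L⁻¹ * x := by positivity
    linarith)
  have h' : envelope k D L c x * Complex.exp (2 * Complex.I * k * x)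
      = (2 * k * D / L * shellBump (x / L) : ℝ) * (c * Complex.exp (2 * Complex.I * k * x)) := by
    rw [envelope, h, inv_mul_eq_div]
    push_cast
    ring
  rw [shell, h', Complex.re_ofReal_mul, halfShell]
  ring

/-- The phase for which a shell of frequency `2k` and inner radius `L` makes the Neumann solution
at energy `k²` of the potential `V` decay: it solves `i c conj Z = Z` for the amplitude `Z` at `L`
(also for `Z = 0`, where the division gives `c = 0`). -/
noncomputable def adaptedPhase (k L : ℝ) (V : ℝ → ℝ) : ℂ :=
  -Complex.I * (amplitude k (neumannSol V k) L / conj (amplitude k (neumannSol V k) L))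

theorem norm_adaptedPhase_le (k L : ℝ) (V : ℝ → ℝ) : ‖adaptedPhase k L V‖ ≤ 1 := by
  rw [adaptedPhase, norm_mul, norm_div, RCLike.norm_conj]
  simpa using div_self_le_one _

theorem adaptedPhase_spec (k L : ℝ) (V : ℝ → ℝ) :
    Complex.I * adaptedPhase k L V * conj (amplitude k (neumannSol V k) L)
      = amplitude k (neumannSol V k) L := by
  rw [adaptedPhase]
  rcases eq_or_ne (amplitude k (neumannSol V k) L) 0 with h | h
  · simp [h]
  · have h' : conj (amplitude k (neumannSol V k) L) ≠ 0 := by simpa using h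
    field_simp
    linear_combination -Complex.I_sq

/-- The sum of the first shells, of frequencies `2 k j` and strengths `D j`; the phase of each shell
is adapted to the sum of the preceding ones. -/
noncomputable def partialPotential (k D : ℕ → ℝ) : ℕ → ℝ → ℝ
  | 0 => 0
  | j + 1 => fun x => partialPotential k D j x +
      shell (k j) (D j) (2 ^ j) (adaptedPhase (k j) (2 ^ j) (partialPotential k D j)) x

/-- The phases in `partialPotential`. -/
noncomputable def shellPhase (k D : ℕ → ℝ) (j : ℕ) : ℂ :=
  adaptedPhase (k j) (2 ^ j) (partialPotential k D j)

/-- The sum of all shells; the supports of the summands have disjoint interiors. -/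
noncomputable def potential (k D : ℕ → ℝ) (x : ℝ) : ℝ :=
  ∑' j, shell (k j) (D j) (2 ^ j) (shellPhase k D j) x

variable (k D : ℕ → ℝ)

theorem partialPotential_eq_sum (N : ℕ) (x : ℝ) :
    partialPotential k D N x =
      ∑ j ∈ Finset.range N, shell (k j) (D j) (2 ^ j) (shellPhase k D j) x := by
  induction N with
  | zero => rfl
  | succ N ih => rw [Finset.sum_range_succ, ← ih]; rfl

theorem contDiff_partialPotential (N : ℕ) : ContDiff ℝ ∞ (partialPotential k D N) := by
  induction N with
  | zero => exact contDiff_const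
  | succ N ih => exact ih.add (contDiff_shell _ _ _ _)

theorem potential_eq_partialPotential {N : ℕ} {x : ℝ} (hx : |x| ≤ 2 ^ N) :
    potential k D x = partialPotential k D N x := by
  rw [partialPotential_eq_sum, potential]
  refine tsum_eq_sum fun j hj => shell_eq_zero _ _ _ (by positivity) (Or.inl ?_)
  rw [Finset.mem_range, not_lt] at hj
  exact hx.trans (pow_le_pow_right₀ (by norm_num) hj)

theorem exists_abs_lt_two_pow (x : ℝ) : ∃ N : ℕ, |x| < 2 ^ N := pow_unbounded_of_one_lt _ one_lt_two

theorem contDiff_potential : ContDiff ℝ ∞ (potential k D) := by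
  rw [contDiff_iff_contDiffAt]
  intro x
  obtain ⟨N, hN⟩ := exists_abs_lt_two_pow x
  refine (contDiff_partialPotential k D N).contDiffAt.congr_of_eventuallyEq ?_
  filter_upwards [(continuous_abs.isOpen_preimage _ isOpen_Iio).mem_nhds hN] with z hz
  exact potential_eq_partialPotential k D (le_of_lt hz)

theorem potential_neg (x : ℝ) : potential k D (-x) = potential k D x := by
  simp only [potential, shell_neg]

/-- At most one shell is nonzero at a given point. -/
theorem exists_forall_ne_envelope_eq_zero (x : ℝ) :
    ∃ J : ℕ, ∀ j, j ≠ J → ∀ k D c, envelope k D (2 ^ j) c x = 0 := by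
  rcases le_total |x| 1 with h | h
  · exact ⟨0, fun j _ k D c => envelope_eq_zero k D c (by positivity)
      (Or.inl (h.trans (one_le_pow₀ (by norm_num))))⟩
  · obtain ⟨J, h1, h2⟩ := exists_nat_pow_near h (one_lt_two (α := ℝ))
    refine ⟨J, fun j hj k D c => envelope_eq_zero k D c (by positivity) ?_⟩
    rcases lt_or_gt_of_ne hj with h3 | h3
    · right
      rw [← pow_succ']
      exact (pow_le_pow_right₀ (by norm_num) h3).trans h1
    · left
      exact h2.le.trans (pow_le_pow_right₀ (by norm_num) h3)

theorem potential_eq_halfShell {j : ℕ} {x : ℝ} (hx : x ∈ Icc ((2 : ℝ) ^ j) (2 * 2 ^ j)) :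
    potential k D x = halfShell (k j) (D j) (2 ^ j) (shellPhase k D j) x := by
  have h0 : (0 : ℝ) < 2 ^ j := by positivity
  have hx0 : 0 ≤ x := h0.le.trans hx.1
  rw [potential, tsum_eq_single j, shell_eq_halfShell _ _ _ h0 hx0]
  intro i hi
  refine shell_eq_zero _ _ _ (by positivity) ?_
  rw [abs_of_nonneg hx0]
  rcases lt_or_gt_of_ne hi with h | h
  · right
    rw [← pow_succ']
    exact (pow_le_pow_right₀ (by norm_num) h).trans hx.1
  · left
    refine hx.2.trans ?_
    rw [← pow_succ']
    exact pow_le_pow_right₀ (by norm_num) h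

/-- The phases are adapted to the full potential too, since it agrees with the partial sum inside
the shell. -/
theorem shellPhase_spec (j : ℕ) :
    Complex.I * shellPhase k D j * conj (amplitude (k j) (neumannSol (potential k D) (k j)) (2 ^ j))
      = amplitude (k j) (neumannSol (potential k D) (k j)) (2 ^ j) := by
  have h := neumannSol_congr (contDiff_potential k D).continuous
    (contDiff_partialPotential k D j).continuous (k := k j) (T := 2 ^ j)
    (fun x hx => potential_eq_partialPotential k D (by rw [abs_of_nonneg hx.1]; exact hx.2))
    (2 ^ j) ⟨by positivity, le_rfl⟩
  have h' : amplitude (k j) (neumannSol (potential k D) (k j)) (2 ^ j)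
      = amplitude (k j) (neumannSol (partialPotential k D j) (k j)) (2 ^ j) := by
    rw [amplitude, amplitude, h.1, h.2]
  rw [h']
  exact adaptedPhase_spec _ _ _

end Potential

/-! ### Decay of the eigenfunctions -/

section Decay

open Set
open scoped ComplexConjugate

/-- The strength of the `j`-th shell: it is switched off until the gate of its index. -/
noncomputable def gatedStrength (gate : ℕ+ → ℕ) (j : ℕ) : ℝ :=
  if gate (visit j) ≤ j then strength (visit j) else 0

/-- The amplitude of each Neumann solution decays like `x⁻²`: eventually it at most doubles in each
shell, and it shrinks by `2 / 8 ^ period m` whenever `m` is served. -/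
theorem exists_amplitude_decay {κ : ℕ+ → ℝ} (hκ : ∀ n, 0 < κ n) {gate : ℕ+ → ℕ} (m : ℕ+)
    (hgate : ∃ J, gate m ≤ J ∧ ∀ n j, J ≤ j → gate n ≤ j →
        ShellControl (κ n) (κ m) (strength n) j) :
    ∃ C, ∀ x, 0 ≤ x → (1 + x ^ 2) * ‖amplitude (κ m)
      (neumannSol (potential (fun j => κ (visit j)) (gatedStrength gate)) (κ m)) x‖ ≤ C := by
  obtain ⟨J, hJm, hJ⟩ := hgate
  set k : ℕ → ℝ := fun j => κ (visit j) with hk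
  set D := gatedStrength gate with hD
  set W := potential k D with hW
  set y := neumannSol W (κ m) with hy
  have hWc : Continuous W := (contDiff_potential k D).continuous
  have hsol : SolvesOn W (κ m) y.1 y.2 univ := (neumannSol_spec hWc (κ m)).2.2
  have hstep : ∀ j, J ≤ j →
      (∀ x ∈ Icc ((2 : ℝ) ^ j) (2 * 2 ^ j),
        ‖amplitude (κ m) y x‖ ≤ 2 * ‖amplitude (κ m) y (2 ^ j)‖) ∧
      (visit j = m → ‖amplitude (κ m) y (2 ^ (j + 1))‖ ≤
        2 * ((8 : ℝ) ^ period m)⁻¹ * ‖amplitude (κ m) y (2 ^ j)‖) := by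
    intro j hj
    have hWj : ∀ x ∈ Icc ((2 : ℝ) ^ j) (2 * 2 ^ j),
        W x = halfShell (k j) (D j) (2 ^ j) (shellPhase k D j) x :=
      fun x hx => potential_eq_halfShell k D hx
    have hsolj : SolvesOn W (κ m) y.1 y.2 (Icc (2 ^ j) (2 * 2 ^ j)) := fun x _ => hsol x trivial
    by_cases hon : gate (visit j) ≤ j
    · have hDj : D j = strength (visit j) := if_pos hon
      rw [hDj] at hWj
      obtain ⟨h1, h2⟩ := hJ (visit j) j hj hon (shellPhase k D j) W y (norm_adaptedPhase_le _ _ _)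
        (fun h => by
          have := shellPhase_spec k D j
          rw [← hW, show k j = κ m from h, ← hy] at this
          exact this) hsolj hWj
      refine ⟨h1, fun hjm => ?_⟩
      rw [pow_succ', ← exp_neg_strength m, ← hjm]
      rw [hjm] at h2 ⊢
      exact h2 rfl
    · have hDj : D j = 0 := if_neg hon
      refine ⟨fun x hx => ?_, fun hjm => absurd (hJm.trans hj) (hjm ▸ hon)⟩
      rw [amplitude_eq_of_free (hκ m) hsolj (fun x hx => by
        rw [hWj x hx, hDj, halfShell]; simp) x hx]
      linarith [norm_nonneg (amplitude (κ m) y (2 ^ j))]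
  obtain ⟨C₁, hC₁⟩ := exists_bound_of_recurrent_decay
    (ρ := fun j => ‖amplitude (κ m) y (2 ^ j)‖) (fun j => norm_nonneg _) (J := J) (period_pos m)
    (fun j hj => (hstep j hj).1 _ ⟨by rw [pow_succ']; linarith [pow_pos (two_pos (α := ℝ)) j],
      by rw [pow_succ']⟩)
    (fun j hj => by
      obtain ⟨i, hji, hiP, hi⟩ := exists_visit_eq m j
      exact ⟨i, hji, hiP, (hstep i (hj.trans hji)).2 hi⟩)
  have hcont : Continuous (amplitude (κ m) y) := continuous_iff_continuousAt.2 fun x =>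
    (hasDerivAt_amplitude (hκ m) hsol (mem_univ x)).continuousAt
  obtain ⟨C₂, hC₂⟩ := isCompact_Icc.exists_bound_of_continuousOn (s := Icc (0 : ℝ) (2 ^ J))
    (f := fun x => (1 + x ^ 2 : ℝ) * ‖amplitude (κ m) y x‖) (by fun_prop)
  refine ⟨max (16 * C₁) C₂, fun x hx => ?_⟩
  rcases le_or_gt x (2 ^ J) with hxJ | hxJ
  · exact ((le_abs_self _).trans (hC₂ x ⟨hx, hxJ⟩)).trans (le_max_right _ _)
  · refine le_trans ?_ (le_max_left _ _)
    have hx1 : 1 ≤ x := (one_le_pow₀ (by norm_num)).trans hxJ.le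
    obtain ⟨j, h1, h2⟩ := exists_nat_pow_near hx1 (one_lt_two (α := ℝ))
    have hj : J ≤ j := by
      have : (2 : ℝ) ^ J < 2 ^ (j + 1) := hxJ.trans h2
      rw [pow_lt_pow_iff_right₀ one_lt_two] at this
      omega
    have h3 := (hstep j hj).1 x ⟨h1, by rw [← pow_succ']; exact h2.le⟩
    have h4 : 1 + x ^ 2 ≤ 8 * 4 ^ j := by
      have e : (2 : ℝ) ^ (j + 1) * 2 ^ (j + 1) = 4 * 4 ^ j := by
        rw [← mul_pow, pow_succ]; norm_num; ring
      nlinarith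
    calc (1 + x ^ 2) * ‖amplitude (κ m) y x‖
        ≤ 8 * 4 ^ j * (2 * ‖amplitude (κ m) y (2 ^ j)‖) := by gcongr
      _ = 16 * (4 ^ j * ‖amplitude (κ m) y (2 ^ j)‖) := by ring
      _ ≤ 16 * C₁ := by gcongr; exact hC₁ j hj

theorem exists_neumannSol_decay {V : ℝ → ℝ} (hV : Continuous V) (heven : ∀ x, V (-x) = V x)
    {k C : ℝ} (hk : 0 < k)
    (hC : ∀ x, 0 ≤ x → (1 + x ^ 2) * ‖amplitude k (neumannSol V k) x‖ ≤ C) (x : ℝ) :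
    |(neumannSol V k).1 x| ≤ C / (1 + x ^ 2) ∧ |(neumannSol V k).2 x| ≤ k * C := by
  have key : ∀ x, 0 ≤ x →
      |(neumannSol V k).1 x| ≤ C / (1 + x ^ 2) ∧ |(neumannSol V k).2 x| ≤ k * C := by
    intro x hx
    have h1 : 0 < 1 + x ^ 2 := by positivity
    refine ⟨(abs_fst_le_norm_amplitude k _ x).trans ?_,
      (abs_snd_le_norm_amplitude hk _ x).trans ?_⟩
    · rw [le_div_iff₀ h1, mul_comm]; exact hC x hx
    · refine mul_le_mul_of_nonneg_left (le_trans ?_ (hC x hx)) hk.le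
      exact le_mul_of_one_le_left (norm_nonneg _) (by linarith [sq_nonneg x])
  rcases le_total 0 x with hx | hx
  · exact key x hx
  · have h := key (-x) (by linarith)
    obtain ⟨h1, h2⟩ := neumannSol_neg hV heven k x
    rw [h1, h2, abs_neg, neg_sq] at h
    exact h

end Decay

/-! ### Symbol estimates -/

section Symbol

open Set
open scoped ComplexConjugate

theorem bracket_pos (x : ℝ) : 0 < bracket x := Real.sqrt_pos.2 (by positivity)

theorem continuous_bracket : Continuous bracket := by unfold bracket; fun_prop

theorem bracket_le_one_add {x : ℝ} (hx : 0 ≤ x) : bracket x ≤ 1 + x :=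
  Real.sqrt_le_iff.2 ⟨by linarith, by nlinarith⟩

theorem abs_mul_bracket_le {b : ℝ} (hb : |b| ≤ 1) (x : ℝ) : |b| * bracket x ≤ bracket (b * x) := by
  refine Real.le_sqrt_of_sq_le ?_
  have h : |b| ^ 2 ≤ 1 := pow_le_one₀ (abs_nonneg b) hb
  rw [mul_pow, bracket, Real.sq_sqrt (by positivity)]
  rw [sq_abs] at *
  nlinarith

theorem exists_exp_neg_le_bracket (N : ℕ) :
    ∃ C : ℝ, 0 ≤ C ∧ ∀ t : ℝ, 0 ≤ t → Real.exp (-t) ≤ C * bracket t ^ (-(N : ℤ)) := by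
  refine ⟨N.factorial * Real.exp 1, by positivity, fun t ht => ?_⟩
  rw [zpow_neg, zpow_natCast, ← div_eq_mul_inv, le_div_iff₀ (pow_pos (bracket_pos t) N)]
  have h1 := Real.pow_div_factorial_le_exp (1 + t) (by linarith) N
  rw [div_le_iff₀ (by positivity)] at h1
  calc Real.exp (-t) * bracket t ^ N ≤ Real.exp (-t) * (1 + t) ^ N := by
        have := bracket_pos t
        gcongr
        exact bracket_le_one_add ht
    _ ≤ Real.exp (-t) * (Real.exp (1 + t) * N.factorial) := by gcongr
    _ = N.factorial * (Real.exp (-t) * Real.exp (1 + t)) := by ring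
    _ = _ := by rw [← Real.exp_add]; simp

theorem contDiff_ofReal_shellBump : ContDiff ℝ ∞ fun y => (shellBump y : ℂ) :=
  Complex.ofRealCLM.contDiff.comp contDiff_shellBump

theorem hasCompactSupport_iteratedDeriv {f : ℝ → ℂ} (hf : HasCompactSupport f) (i : ℕ) :
    HasCompactSupport (iteratedDeriv i f) := by
  induction i with
  | zero => simpa using hf
  | succ i ih => rw [iteratedDeriv_succ]; exact ih.deriv

/-- Dilates `y ↦ shellBump (b y)` with `|b| ≤ 1` are symbols of order `0`, uniformly in `b`: on the
support of the dilate `|b| ⟨x⟩` is bounded. -/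
theorem exists_dilate_bound (i : ℕ) :
    ∃ H : ℝ, 0 ≤ H ∧ ∀ b x : ℝ, |b| ≤ 1 →
      ‖iteratedDeriv i (fun x => (shellBump (b * x) : ℂ)) x‖ ≤ H * bracket x ^ (-(i : ℤ)) := by
  have hsupp : HasCompactSupport fun y => (shellBump y : ℂ) :=
    hasCompactSupport_shellBump.comp_left (g := fun r : ℝ => (r : ℂ)) Complex.ofReal_zero
  have hcont : Continuous (iteratedDeriv i fun y => (shellBump y : ℂ)) :=
    contDiff_ofReal_shellBump.continuous_iteratedDeriv i (by exact_mod_cast le_top)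
  have hsupp' : HasCompactSupport
      fun y => ((bracket y ^ i : ℝ) : ℂ) * iteratedDeriv i (fun y => (shellBump y : ℂ)) y :=
    (hasCompactSupport_iteratedDeriv hsupp i).mul_left
  obtain ⟨H, hH⟩ := hsupp'.exists_bound_of_continuous
    ((Complex.continuous_ofReal.comp (continuous_bracket.pow i)).mul hcont)
  refine ⟨H, (norm_nonneg _).trans (hH 0), fun b x hb => ?_⟩
  rw [iteratedDeriv_comp_const_smul (n := i) (f := fun y => (shellBump y : ℂ))
    (contDiff_ofReal_shellBump.of_le (by exact_mod_cast le_top)) b]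
  have h1 := hH (b * x)
  have hbx := bracket_pos (b * x)
  rw [norm_mul, Complex.norm_real, Real.norm_of_nonneg (by positivity)] at h1
  rw [zpow_neg, zpow_natCast, ← div_eq_mul_inv, le_div_iff₀ (pow_pos (bracket_pos x) i), norm_smul,
    norm_pow, Real.norm_eq_abs]
  calc |b| ^ i * ‖_‖ * bracket x ^ i = (|b| * bracket x) ^ i * ‖_‖ := by ring
    _ ≤ bracket (b * x) ^ i * ‖_‖ := by
      have := bracket_pos x
      gcongr
      exact abs_mul_bracket_le hb x
    _ ≤ H := h1

theorem exists_envelope_bound (i : ℕ) :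
    ∃ H : ℝ, 0 ≤ H ∧ ∀ (k D L : ℝ) (c : ℂ) (x : ℝ), 0 ≤ k → 0 ≤ D → 1 ≤ L → ‖c‖ ≤ 1 →
      ‖iteratedDeriv i (envelope k D L c) x‖ ≤ 4 * k * D / L * (H * bracket x ^ (-(i : ℤ))) := by
  obtain ⟨H, hH0, hH⟩ := exists_dilate_bound i
  refine ⟨H, hH0, fun k D L c x hk hD hL hc => ?_⟩
  have hd : ∀ b : ℝ, ContDiffAt ℝ i (fun x : ℝ => (shellBump (b * x) : ℂ)) x := fun b =>
    ((contDiff_ofReal_shellBump.comp (contDiff_const.mul contDiff_id)).contDiffAt).of_le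
      (by exact_mod_cast le_top)
  have hL0 : 0 < L := by linarith
  have hb : |L⁻¹| ≤ 1 := by
    rw [abs_of_pos (inv_pos.2 hL0)]; exact inv_le_one_of_one_le₀ hL
  have hb' : |-L⁻¹| ≤ 1 := by rwa [abs_neg]
  have h1 := hH _ x hb
  have h2 := hH _ x hb'
  unfold envelope
  rw [iteratedDeriv_const_mul_field, iteratedDeriv_fun_add (contDiffAt_const.mul (hd _))
    (contDiffAt_const.mul (hd _)), iteratedDeriv_const_mul_field, iteratedDeriv_const_mul_field,
    norm_mul, Complex.norm_real, Real.norm_of_nonneg (by positivity)]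
  have hx := bracket_pos x
  calc 2 * k * D / L * ‖_‖
      ≤ 2 * k * D / L * (1 * (H * bracket x ^ (-(i : ℤ))) + 1 * (H * bracket x ^ (-(i : ℤ)))) := by
        gcongr
        refine (norm_add_le _ _).trans ?_
        rw [norm_mul, norm_mul, RCLike.norm_conj]
        gcongr
    _ = _ := by ring

/-- The coefficient of `e^{2iκₙx}` in the sum of the shells that serve `n`, for phases `c`. -/
noncomputable def coefficient (κ : ℕ+ → ℝ) (D : ℕ → ℝ) (c : ℕ → ℂ) (n : ℕ+) (x : ℝ) : ℂ :=
  ∑' j, if visit j = n then envelope (κ n) (D j) (2 ^ j) (c j) x else 0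

variable {κ : ℕ+ → ℝ} {D : ℕ → ℝ} {c : ℕ → ℂ}

theorem coefficient_eq_sum (κ : ℕ+ → ℝ) (D : ℕ → ℝ) (c : ℕ → ℂ) (n : ℕ+) {N : ℕ} {x : ℝ}
    (hx : |x| ≤ 2 ^ N) :
    coefficient κ D c n x = ∑ j ∈ Finset.range N,
      if visit j = n then envelope (κ n) (D j) (2 ^ j) (c j) x else 0 := by
  refine tsum_eq_sum fun j hj => ?_
  rw [Finset.mem_range, not_lt] at hj
  rw [envelope_eq_zero _ _ _ (by positivity)
    (Or.inl (hx.trans (pow_le_pow_right₀ (by norm_num) hj))), ite_self]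

theorem coefficient_eventuallyEq (κ : ℕ+ → ℝ) (D : ℕ → ℝ) (c : ℕ → ℂ) (n : ℕ+) (x : ℝ) :
    ∃ N : ℕ, coefficient κ D c n =ᶠ[nhds x] fun x => ∑ j ∈ Finset.range N,
      if visit j = n then envelope (κ n) (D j) (2 ^ j) (c j) x else 0 := by
  obtain ⟨N, hN⟩ := exists_abs_lt_two_pow x
  refine ⟨N, ?_⟩
  filter_upwards [(continuous_abs.isOpen_preimage _ isOpen_Iio).mem_nhds hN] with z hz
  exact coefficient_eq_sum κ D c n (le_of_lt hz)

theorem contDiff_ite_envelope (k D L : ℝ) (c : ℂ) (p : Prop) [Decidable p] :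
    ContDiff ℝ ∞ fun x => if p then envelope k D L c x else 0 := by
  split_ifs
  · exact contDiff_envelope k D L c
  · exact contDiff_const

theorem contDiff_coefficient (κ : ℕ+ → ℝ) (D : ℕ → ℝ) (c : ℕ → ℂ) (n : ℕ+) :
    ContDiff ℝ ∞ (coefficient κ D c n) := by
  rw [contDiff_iff_contDiffAt]
  intro x
  obtain ⟨N, hN⟩ := coefficient_eventuallyEq κ D c n x
  exact (ContDiff.sum fun j _ =>
    contDiff_ite_envelope _ _ _ _ _).contDiffAt.congr_of_eventuallyEq hN

theorem isRapidSymbolFamily_coefficient (hκ : ∀ n, 0 < κ n) (hD : ∀ j, 0 ≤ D j)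
    (hc : ∀ j, ‖c j‖ ≤ 1)
    (hsmall : ∀ j, 4 * κ (visit j) * D j / 2 ^ j ≤
      Real.exp (-((visit j : ℝ) + κ (visit j))) * (3 / 4) ^ j) :
    IsRapidSymbolFamily κ (coefficient κ D c) := by
  refine ⟨fun n => contDiff_coefficient κ D c n, fun i N => ?_⟩
  obtain ⟨H, hH0, hH⟩ := exists_envelope_bound i
  obtain ⟨C, hC0, hC⟩ := exists_exp_neg_le_bracket N
  refine ⟨4 * H * C ^ 2, fun n x => ?_⟩
  obtain ⟨M, hM⟩ := coefficient_eventuallyEq κ D c n x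
  have hx := bracket_pos x
  have hκn := hκ n
  rw [hM.iteratedDeriv_eq, iteratedDeriv_fun_sum fun j _ =>
    (contDiff_ite_envelope _ _ _ _ _).contDiffAt.of_le (by exact_mod_cast le_top)]
  have hterm : ∀ j, ‖iteratedDeriv i (fun x => if visit j = n then
      envelope (κ n) (D j) (2 ^ j) (c j) x else 0) x‖
        ≤ Real.exp (-(n + κ n)) * (H * bracket x ^ (-(i : ℤ))) * (3 / 4) ^ j := by
    intro j
    split_ifs with hj
    · have h1 := hsmall j
      rw [hj] at h1
      calc _ ≤ 4 * κ n * D j / 2 ^ j * (H * bracket x ^ (-(i : ℤ))) :=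
            hH _ _ _ _ x hκn.le (hD j) (one_le_pow₀ (by norm_num)) (hc j)
        _ ≤ Real.exp (-(n + κ n)) * (3 / 4) ^ j * (H * bracket x ^ (-(i : ℤ))) := by gcongr
        _ = _ := by ring
    · have : iteratedDeriv i (fun _ : ℝ => (0 : ℂ)) x = 0 := by
        rw [iteratedDeriv_const]; simp
      rw [this, norm_zero]
      positivity
  have hgeom : ∑ j ∈ Finset.range M, (3 / 4 : ℝ) ^ j ≤ 4 := by
    refine ((summable_geometric_of_lt_one (by norm_num) (by norm_num)).sum_le_tsum _
      fun j _ => by positivity).trans (le_of_eq ?_)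
    rw [tsum_geometric_of_lt_one (by norm_num) (by norm_num)]
    norm_num
  calc ‖∑ j ∈ Finset.range M, iteratedDeriv i (fun x => if visit j = n then
        envelope (κ n) (D j) (2 ^ j) (c j) x else 0) x‖
      ≤ ∑ j ∈ Finset.range M,
        Real.exp (-(n + κ n)) * (H * bracket x ^ (-(i : ℤ))) * (3 / 4) ^ j :=
        norm_sum_le_of_le _ fun j _ => hterm j
    _ ≤ Real.exp (-(n + κ n)) * (H * bracket x ^ (-(i : ℤ))) * 4 := by
        rw [← Finset.mul_sum]; gcongr
    _ = Real.exp (-n) * Real.exp (-κ n) * (H * bracket x ^ (-(i : ℤ))) * 4 := by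
        rw [← Real.exp_add]; ring_nf
    _ ≤ (C * bracket n ^ (-(N : ℤ))) * (C * bracket (κ n) ^ (-(N : ℤ))) *
        (H * bracket x ^ (-(i : ℤ))) * 4 := by
        have := bracket_pos n
        gcongr
        exacts [hC _ (by positivity), hC _ hκn.le]
    _ = _ := by ring

/-- At each point a single index `n`, the one served by the shell containing the point,
contributes to the sum over `n`. -/
theorem hasSum_coefficient (κ : ℕ+ → ℝ) (D : ℕ → ℝ) (c : ℕ → ℂ) (e : ℕ+ → ℂ) {x : ℝ} {J : ℕ}
    (hJ : ∀ j, j ≠ J → ∀ k D c, envelope k D (2 ^ j) c x = 0) :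
    HasSum (fun n => e n * coefficient κ D c n x)
      (e (visit J) * envelope (κ (visit J)) (D J) (2 ^ J) (c J) x) := by
  have h : ∀ n, coefficient κ D c n x =
      if visit J = n then envelope (κ n) (D J) (2 ^ J) (c J) x else 0 := fun n =>
    tsum_eq_single J fun j hj => by rw [hJ j hj, ite_self]
  have h1 := hasSum_single (f := fun n => e n * coefficient κ D c n x) (visit J)
    fun n hn => by simp [h, hn.symm]
  simpa [h] using h1

end Symbol

/-! ### From classical solutions to eigenvectors -/

section Eigenvector

theorem integrable_schwartz_mul (φ : 𝓢(ℝ, ℂ)) {f : ℝ → ℂ} (hf : Continuous f) {C : ℝ}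
    (hC : ∀ x, ‖f x‖ ≤ C) : Integrable fun x => φ x * f x :=
  φ.integrable.mul_bdd hf.aestronglyMeasurable (Filter.Eventually.of_forall hC)

/-- Integration by parts against a Schwartz function; `u`, `u'` and `u''` need only be bounded. -/
theorem integral_laplacian_mul_eq {u v w : ℝ → ℂ} (hu : ∀ x, HasDerivAt u (v x) x)
    (hv : ∀ x, HasDerivAt v (w x) x) (hw : Continuous w) {C : ℝ} (hCu : ∀ x, ‖u x‖ ≤ C)
    (hCv : ∀ x, ‖v x‖ ≤ C) (hCw : ∀ x, ‖w x‖ ≤ C) (φ : 𝓢(ℝ, ℂ)) :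
    ∫ x, (Δ φ) x * u x = ∫ x, φ x * w x := by
  have hcu : Continuous u := continuous_iff_continuousAt.2 fun x => (hu x).continuousAt
  have hcv : Continuous v := continuous_iff_continuousAt.2 fun x => (hv x).continuousAt
  set φ₁ := SchwartzMap.derivCLM ℂ ℂ φ with hφ₁
  set φ₂ := SchwartzMap.derivCLM ℂ ℂ φ₁ with hφ₂
  have hd : ∀ x, HasDerivAt φ (φ₁ x) x := fun x => φ.hasDerivAt x
  have hd₁ : ∀ x, HasDerivAt φ₁ (φ₂ x) x := fun x => φ₁.hasDerivAt x
  have hΔ : ∀ x, (Δ φ) x = φ₂ x := by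
    intro x
    rw [SchwartzMap.laplacian_apply, InnerProductSpace.laplacian_eq_iteratedDeriv_real,
      iteratedDeriv_succ, iteratedDeriv_one, hφ₂, SchwartzMap.derivCLM_apply]
    rfl
  have h1 := integral_mul_deriv_eq_deriv_mul_of_integrable (u := u) (v := φ₁) (u' := v) (v' := φ₂)
    (fun x _ => hu x) (fun x _ => hd₁ x)
    ((integrable_schwartz_mul φ₂ hcu hCu).congr (.of_forall fun x => mul_comm _ _))
    ((integrable_schwartz_mul φ₁ hcv hCv).congr (.of_forall fun x => mul_comm _ _))
    ((integrable_schwartz_mul φ₁ hcu hCu).congr (.of_forall fun x => mul_comm _ _))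
  have h2 := integral_mul_deriv_eq_deriv_mul_of_integrable (u := v) (v := φ) (u' := w) (v' := φ₁)
    (fun x _ => hv x) (fun x _ => hd x)
    ((integrable_schwartz_mul φ₁ hcv hCv).congr (.of_forall fun x => mul_comm _ _))
    ((integrable_schwartz_mul φ hw hCw).congr (.of_forall fun x => mul_comm _ _))
    ((integrable_schwartz_mul φ hcv hCv).congr (.of_forall fun x => mul_comm _ _))
  calc ∫ x, (Δ φ) x * u x = ∫ x, u x * φ₂ x := by simp only [hΔ, mul_comm]
    _ = ∫ x, w x * φ x := by rw [h1, h2, neg_neg]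
    _ = _ := by simp only [mul_comm]

/-- An `L²` function whose distributional Laplacian is in `L²` belongs to `H²`. -/
theorem mem_sobolevH2_of_laplacian {f g : L2} (h : Δ (toDist f) = toDist g) : f ∈ sobolevH2 := by
  have hb : besselPotential ℝ ℂ 2 (toDist f) = toDist f +
      fourierMultiplierCLM ℂ (fun x : ℝ => Complex.ofReal (‖x‖ ^ 2)) (toDist f) := by
    have h1 : (fun x : ℝ => Complex.ofReal ((1 + ‖x‖ ^ 2) ^ ((2 : ℝ) / 2)))
        = (fun _ => (1 : ℂ)) + fun x : ℝ => Complex.ofReal (‖x‖ ^ 2) := by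
      ext x
      simp
    rw [besselPotential, h1, fourierMultiplierCLM_apply, smulLeftCLM_add (by fun_prop)
      (by fun_prop), add_apply, smulLeftCLM_const, one_smul,
      FourierTransform.fourierInv_add, FourierTransform.fourierInv_fourier_eq,
      fourierMultiplierCLM_apply]
  have hπ : ((2 * Real.pi) ^ 2 : ℝ) ≠ 0 := by positivity
  have hm : fourierMultiplierCLM ℂ (fun x : ℝ => Complex.ofReal (‖x‖ ^ 2)) (toDist f)
      = (-((2 * Real.pi) ^ 2)⁻¹ : ℝ) • toDist g := by
    rw [← h, laplacian_eq_fourierMultiplierCLM, smul_smul, neg_mul_neg, inv_mul_cancel₀ hπ, one_smul]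
  refine ⟨f + ((-((2 * Real.pi) ^ 2)⁻¹ : ℝ) : ℂ) • g, ?_⟩
  rw [hb, hm, ← Lp.toTemperedDistributionCLM_apply, map_add, map_smul, Complex.coe_smul]

theorem laplacian_toDist_eq {u v w : ℝ → ℂ} (hu : ∀ x, HasDerivAt u (v x) x)
    (hv : ∀ x, HasDerivAt v (w x) x) (hw : Continuous w) {C : ℝ} (hCu : ∀ x, ‖u x‖ ≤ C)
    (hCv : ∀ x, ‖v x‖ ≤ C) (hCw : ∀ x, ‖w x‖ ≤ C) (hu2 : MemLp u 2) (hw2 : MemLp w 2) :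
    Δ (toDist (hu2.toLp u)) = toDist (hw2.toLp w) := by
  ext φ
  rw [laplacian_apply_apply, toDist, Lp.toTemperedDistributionCLM_apply,
    Lp.toTemperedDistribution_apply, toDist, Lp.toTemperedDistributionCLM_apply,
    Lp.toTemperedDistribution_apply]
  have e1 : ∫ x, (Δ φ) x • (hu2.toLp u) x = ∫ x, (Δ φ) x * u x :=
    integral_congr_ae (by filter_upwards [hu2.coeFn_toLp] with x hx; rw [hx, smul_eq_mul])
  have e2 : ∫ x, φ x • (hw2.toLp w) x = ∫ x, φ x * w x :=
    integral_congr_ae (by filter_upwards [hw2.coeFn_toLp] with x hx; rw [hx, smul_eq_mul])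
  rw [e1, e2]
  exact integral_laplacian_mul_eq hu hv hw hCu hCv hCw φ

theorem memLp_two_of_le_inv {f : ℝ → ℂ} (hf : Continuous f) {C : ℝ}
    (hC : ∀ x, ‖f x‖ ≤ C / (1 + x ^ 2)) : MemLp f 2 := by
  rw [memLp_two_iff_integrable_sq_norm hf.aestronglyMeasurable]
  refine (integrable_inv_one_add_sq.const_mul (C ^ 2)).mono' (hf.norm.pow 2).aestronglyMeasurable
    (.of_forall fun x => ?_)
  rw [Real.norm_of_nonneg (by positivity)]
  have h1 : (0 : ℝ) < 1 + x ^ 2 := by positivity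
  calc ‖f x‖ ^ 2 ≤ (C / (1 + x ^ 2)) ^ 2 := by gcongr; exact hC x
    _ = C ^ 2 * (1 + x ^ 2)⁻¹ * (1 + x ^ 2)⁻¹ := by field_simp
    _ ≤ C ^ 2 * (1 + x ^ 2)⁻¹ * 1 := by
        gcongr
        exact inv_le_one_of_one_le₀ (by linarith [sq_nonneg x])
    _ = _ := mul_one _

/-- A classical solution that decays like `x⁻²` is an eigenvector. -/
theorem isEigenvalue_of_decay {V : ℝ → ℝ} (hV : Continuous V) {M : ℝ} (hM : ∀ x, |V x| ≤ M)
    {k C : ℝ} {u v : ℝ → ℝ} (hsol : SolvesOn V k u v Set.univ) (h0 : u 0 ≠ 0)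
    (hu : ∀ x, |u x| ≤ C / (1 + x ^ 2)) (hv : ∀ x, |v x| ≤ C) :
    IsEigenvalue (schrodinger V) ((k : ℂ) ^ 2) := by
  have hC : 0 ≤ C := (abs_nonneg _).trans (hv 0)
  have hM0 : 0 ≤ M := (abs_nonneg _).trans (hM 0)
  have hdu : ∀ x, HasDerivAt (fun x => (u x : ℂ)) (v x : ℂ) x := fun x =>
    (hsol x trivial).1.ofReal_comp
  have hdv : ∀ x, HasDerivAt (fun x => (v x : ℂ)) (((V x - k ^ 2) * u x : ℝ) : ℂ) x := fun x =>
    (hsol x trivial).2.ofReal_comp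
  have hcu : Continuous u := continuous_iff_continuousAt.2 fun x => (hsol x trivial).1.continuousAt
  have hle : ∀ x : ℝ, C / (1 + x ^ 2) ≤ C := fun x =>
    div_le_self hC (by linarith [sq_nonneg x])
  have hw : ∀ x, ‖(((V x - k ^ 2) * u x : ℝ) : ℂ)‖ ≤ (M + k ^ 2) * C / (1 + x ^ 2) := by
    intro x
    rw [Complex.norm_real, Real.norm_eq_abs, abs_mul, mul_div_assoc]
    refine mul_le_mul ((abs_sub _ _).trans ?_) (hu x) (abs_nonneg _) (by positivity)
    rw [abs_of_nonneg (sq_nonneg k)]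
    linarith [hM x]
  have hVu : ∀ x, ‖(V x : ℂ) * (u x : ℂ)‖ ≤ M * C / (1 + x ^ 2) := by
    intro x
    rw [norm_mul, Complex.norm_real, Complex.norm_real, mul_div_assoc]
    exact mul_le_mul (hM x) (hu x) (abs_nonneg _) hM0
  have hcU : Continuous fun x => (u x : ℂ) := Complex.continuous_ofReal.comp hcu
  have hcV : Continuous fun x => (V x : ℂ) := Complex.continuous_ofReal.comp hV
  have hcw : Continuous fun x => (((V x - k ^ 2) * u x : ℝ) : ℂ) :=
    Complex.continuous_ofReal.comp (by fun_prop)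
  have hu2 : MemLp (fun x => (u x : ℂ)) 2 :=
    memLp_two_of_le_inv hcU fun x => by rw [Complex.norm_real]; exact hu x
  have hw2 : MemLp (fun x => (((V x - k ^ 2) * u x : ℝ) : ℂ)) 2 := memLp_two_of_le_inv hcw hw
  have hVu2 : MemLp (fun x => (V x : ℂ) * (u x : ℂ)) 2 := memLp_two_of_le_inv (hcV.mul hcU) hVu
  set f : L2 := hu2.toLp _ with hf
  have hfae : f =ᵐ[volume] fun x => (u x : ℂ) := hu2.coeFn_toLp
  have hlap : Δ (toDist f) = toDist (hw2.toLp _) :=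
    laplacian_toDist_eq hdu hdv hcw (C := C + (M + k ^ 2) * C)
      (fun x => by
        rw [Complex.norm_real]
        refine ((hu x).trans (hle x)).trans (le_add_of_nonneg_right (by positivity)))
      (fun x => by
        rw [Complex.norm_real]
        exact (hv x).trans (le_add_of_nonneg_right (by positivity)))
      (fun x => (hw x).trans ((div_le_self (by positivity) (by linarith [sq_nonneg x])).trans
        (le_add_of_nonneg_left hC))) hu2 hw2
  have hH2 : f ∈ sobolevH2 := mem_sobolevH2_of_laplacian hlap
  have hmul : f ∈ mulDomain V := by
    refine (memLp_congr_ae ?_).mpr hVu2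
    filter_upwards [hfae] with x hx
    rw [hx]
  have hLap : laplacianH2 ⟨f, hH2⟩ = hw2.toLp _ := by
    apply toDist_injective
    rw [toDist_laplacianH2]
    exact hlap
  refine ⟨⟨f, hH2, hmul⟩, ?_, ?_⟩
  · intro hzero
    have hzero' : f = 0 := hzero
    have h1 : (fun x => (u x : ℂ)) =ᵐ[volume] fun _ => (0 : ℂ) := by
      filter_upwards [hfae, Lp.coeFn_zero ℂ 2 (volume : Measure ℝ)] with x hx hx0
      rw [← hx, hzero', hx0, Pi.zero_apply]
    have h2 := (hcU.ae_eq_iff_eq volume continuous_const).1 h1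
    exact h0 (by exact_mod_cast congrFun h2 0)
  · have hact : schrodinger V ⟨f, hH2, hmul⟩
        = -laplacianH2 ⟨f, hH2⟩ + mulOp V ⟨f, hmul⟩ := rfl
    have hmulOp : mulOp V ⟨f, hmul⟩ = MemLp.toLp (fun x => (V x : ℂ) * f x) hmul := rfl
    rw [hact, hLap, hmulOp]
    apply Lp.ext
    filter_upwards [hfae, Lp.coeFn_add (-(hw2.toLp _)) (MemLp.toLp (fun x => (V x : ℂ) * f x) hmul),
      Lp.coeFn_neg (hw2.toLp _), hw2.coeFn_toLp,
      MemLp.coeFn_toLp (f := fun x => (V x : ℂ) * f x) hmul,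
      Lp.coeFn_smul ((k : ℂ) ^ 2) f] with x h1 h2 h3 h4 h5 h6
    rw [h2, h6, Pi.add_apply, h3, Pi.neg_apply, h4, h5, Pi.smul_apply, h1, smul_eq_mul]
    push_cast
    ring

end Eigenvector

end SchrodingerLine

/-! ### Eigenvalues and expansion of the potential -/

theorem theoremB3 (κ : ℕ+ → ℝ) (hκ : ∀ n, 0 < κ n) :
    ∃ W : ℝ → ℝ, ContDiff ℝ ∞ W ∧
      (∀ n, SchrodingerLine.IsEigenvalue (SchrodingerLine.schrodinger W) ((κ n : ℂ) ^ 2)) ∧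
      ∃ (wplus wminus : ℕ+ → ℝ → ℂ) (w₀ : ℝ → ℂ),
        SchrodingerLine.IsRapidSymbolFamily κ wplus ∧
        SchrodingerLine.IsRapidSymbolFamily κ wminus ∧
        ContDiff ℝ ∞ w₀ ∧ HasCompactSupport w₀ ∧
        ∀ x : ℝ,
          Summable (fun n => Complex.exp (2 * Complex.I * κ n * x) * wplus n x) ∧
          Summable (fun n => Complex.exp (-(2 * Complex.I * κ n * x)) * wminus n x) ∧
          (W x : ℂ) =
            (∑' n, Complex.exp (2 * Complex.I * κ n * x) * wplus n x) +
            (∑' n, Complex.exp (-(2 * Complex.I * κ n * x)) * wminus n x) + w₀ x := by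
  obtain ⟨gate, hsmall, hctrl⟩ := SchrodingerLine.exists_gate hκ
  set k : ℕ → ℝ := fun j => κ (SchrodingerLine.visit j) with hk
  set D := SchrodingerLine.gatedStrength gate with hD
  set c := SchrodingerLine.shellPhase k D with hc
  have hc1 : ∀ j, ‖c j‖ ≤ 1 := fun j => SchrodingerLine.norm_adaptedPhase_le _ _ _
  have hc2 : ∀ j, ‖starRingEnd ℂ (c j)‖ ≤ 1 := fun j => by rw [RCLike.norm_conj]; exact hc1 j
  have hD0 : ∀ j, 0 ≤ D j := by
    intro j
    rw [hD, SchrodingerLine.gatedStrength]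
    split_ifs
    exacts [(SchrodingerLine.strength_pos _).le, le_rfl]
  have hsmall' : ∀ j, 4 * κ (SchrodingerLine.visit j) * D j / 2 ^ j ≤
      Real.exp (-((SchrodingerLine.visit j : ℝ) + κ (SchrodingerLine.visit j))) * (3 / 4) ^ j := by
    intro j
    rw [hD, SchrodingerLine.gatedStrength]
    split_ifs with h
    · exact hsmall _ j h
    · rw [mul_zero, zero_div]; positivity
  have hWc := (SchrodingerLine.contDiff_potential k D).continuous
  -- `i = 0` in the symbol estimate bounds the potential itself.
  obtain ⟨H, hH0, hH⟩ := SchrodingerLine.exists_envelope_bound 0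
  have hdecomp : ∀ x : ℝ, ∃ J,
      (∀ j, j ≠ J → ∀ k D c, SchrodingerLine.envelope k D (2 ^ j) c x = 0) ∧
      SchrodingerLine.potential k D x = SchrodingerLine.shell (k J) (D J) (2 ^ J) (c J) x := by
    intro x
    obtain ⟨J, hJ⟩ := SchrodingerLine.exists_forall_ne_envelope_eq_zero x
    refine ⟨J, hJ, tsum_eq_single J fun j hj => ?_⟩
    rw [SchrodingerLine.shell, hJ j hj]
    simp
  have hbound : ∀ x, |SchrodingerLine.potential k D x| ≤ 2 * H := by
    intro x
    obtain ⟨J, hJ, hW⟩ := hdecomp x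
    have h1 := hH (k J) (D J) (2 ^ J) (c J) x (hκ _).le (hD0 J) (one_le_pow₀ (by norm_num)) (hc1 J)
    simp only [iteratedDeriv_zero, Nat.cast_zero, neg_zero, zpow_zero, mul_one] at h1
    have h2 : 4 * k J * D J / 2 ^ J ≤ 1 := by
      refine (hsmall' J).trans (mul_le_one₀ (Real.exp_le_one_iff.2 ?_) (by positivity)
        (pow_le_one₀ (by norm_num) (by norm_num)))
      have := hκ (SchrodingerLine.visit J)
      have : (0 : ℝ) ≤ (SchrodingerLine.visit J : ℝ) := by positivity
      linarith
    have h3 : ‖Complex.exp (2 * Complex.I * k J * x)‖ = 1 := by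
      have : 2 * Complex.I * k J * x = ((2 * k J * x : ℝ) : ℂ) * Complex.I := by push_cast; ring
      rw [this, Complex.norm_exp_ofReal_mul_I]
    rw [hW, SchrodingerLine.shell, abs_mul, abs_of_pos (two_pos (α := ℝ))]
    gcongr
    refine (Complex.abs_re_le_norm _).trans ?_
    rw [norm_mul, h3, mul_one]
    exact h1.trans (mul_le_of_le_one_left hH0 h2)
  -- The shells vanish near `0`, so no compactly supported part is needed.
  refine ⟨SchrodingerLine.potential k D, SchrodingerLine.contDiff_potential k D, fun n => ?_,
    SchrodingerLine.coefficient κ D c, SchrodingerLine.coefficient κ D fun j => starRingEnd ℂ (c j),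
    0, SchrodingerLine.isRapidSymbolFamily_coefficient hκ hD0 hc1 hsmall',
    SchrodingerLine.isRapidSymbolFamily_coefficient hκ hD0 hc2 hsmall',
    contDiff_const, HasCompactSupport.zero, fun x => ?_⟩
  · obtain ⟨C, hC⟩ := SchrodingerLine.exists_amplitude_decay hκ n (hctrl n)
    have hC0 : 0 ≤ C := le_trans (by positivity) (hC 0 le_rfl)
    obtain ⟨h0, -, hsol⟩ := SchrodingerLine.neumannSol_spec hWc (κ n)
    have hdec := SchrodingerLine.exists_neumannSol_decay hWc (SchrodingerLine.potential_neg k D)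
      (hκ n) hC
    have hκn := hκ n
    refine SchrodingerLine.isEigenvalue_of_decay (C := C + κ n * C) hWc hbound hsol
      (by rw [h0]; exact one_ne_zero) (fun x => (hdec x).1.trans ?_) fun x => (hdec x).2.trans ?_
    · gcongr
      exact le_add_of_nonneg_right (by positivity)
    · exact le_add_of_nonneg_left hC0
  · obtain ⟨J, hJ, hW⟩ := hdecomp x
    have hp := SchrodingerLine.hasSum_coefficient κ D c
      (fun n => Complex.exp (2 * Complex.I * κ n * x)) hJ
    have hm := SchrodingerLine.hasSum_coefficient κ D (fun j => starRingEnd ℂ (c j))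
      (fun n => Complex.exp (-(2 * Complex.I * κ n * x))) hJ
    refine ⟨hp.summable, hm.summable, ?_⟩
    rw [hp.tsum_eq, hm.tsum_eq, hW, SchrodingerLine.ofReal_shell, SchrodingerLine.conj_envelope,
      Pi.zero_apply, add_zero]
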